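/- Let $M$ be a smooth manifold of dimension $2n$ with an almost skew-Hermitian structure $(J,g,\tilde g)$: $J$ is a smooth almost complex structure ($J^2=-1$), $g$ is a smooth pseudo-Riemannian metric with $g(JX,JY)=-g(X,Y)$ (hence of signature $(n,n)$), and $\tilde g=g(\cdot,J\cdot)$. Let $\nabla$ be the Levi-Civita connection of $g$, with Christoffel symbols $\Gamma_{ij}^k$. For $u\in T_pM$ with induced coordinates $(x^i,y^i)$ and $X\in T_pM$, let $X^V=(0,X^k)$ and $X^H=(X^k,-y^i\Gamma_{ij}^kX^j)$ in $T_u(TM)$ be the vertical and the horizontal lift of $X$. Define on $TM$ the endomorphism field $J_1$ by $$J_1X^H=X^V,\qquad J_1X^V=-X^H,$$ and the Sasaki metric $\hat g$ by $$\hat g(X^H,Y^H)=\hat g(X^V,Y^V)=g(X,Y),\qquad \hat g(X^H,Y^V)=0 .$$ Then $(TM,J_1,\hat g)$ is an almost Kähler manifold: $\hat g$ is a smooth pseudo-Riemannian metric, $J_1$ is a smooth almost complex structure, $\hat g(J_1\cdot,J_1\cdot)=\hat g$, and the Kähler form $\Phi=\hat g(J_1\cdot,\cdot)$ is closed, $d\Phi=0$.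 Moreover, $(TM,J_1,\hat g)$ is a Kähler manifold (that is, in addition $\hat\nabla J_1=0$ for the Levi-Civita connection $\hat\nabla$ of $\hat g$) if and only if $(M,J,g,\tilde g)$ is flat, i.e. the curvature tensor $R=[\nabla,\nabla]-\nabla_{[\,,\,]}$ of $g$ vanishes identically. -/

import Mathlib

set_option maxSynthPendingDepth 3

open scoped Manifold ContDiff
open Bundle

noncomputable section

namespace SasakiTangent

/-- The pull-back `B(L·, L·)` of a bilinear form `B` along a linear map `L`. -/
def pullForm {S T : Type*} [AddCommGroup S] [Module ℝ S] [TopologicalSpace S]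
    [IsTopologicalAddGroup S] [ContinuousSMul ℝ S] [AddCommGroup T] [Module ℝ T]
    [TopologicalSpace T] [IsTopologicalAddGroup T] [ContinuousSMul ℝ T]
    (B : T →L[ℝ] T →L[ℝ] ℝ) (L : S →L[ℝ] T) : S →L[ℝ] S →L[ℝ] ℝ :=
  (ContinuousLinearMap.precomp ℝ L).comp (B.comp L)

@[simp]
theorem pullForm_apply {S T : Type*} [AddCommGroup S] [Module ℝ S] [TopologicalSpace S]
    [IsTopologicalAddGroup S] [ContinuousSMul ℝ S] [AddCommGroup T] [Module ℝ T]
    [TopologicalSpace T] [IsTopologicalAddGroup T] [ContinuousSMul ℝ T]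
    (B : T →L[ℝ] T →L[ℝ] ℝ) (L : S →L[ℝ] T) (v w : S) :
    pullForm B L v w = B (L v) (L w) := rfl

/-- The trilinear form `½ (D(a,b,c) + D(b,a,c) - D(c,a,b))` in `(a,b,c)`. -/
def koszulForm {V : Type*} [NormedAddCommGroup V] [NormedSpace ℝ V]
    (D : V →L[ℝ] V →L[ℝ] V →L[ℝ] ℝ) : V →L[ℝ] V →L[ℝ] V →L[ℝ] ℝ :=
  (1 / 2 : ℝ) • (D + D.flip
    - (ContinuousLinearMap.flipₗᵢ ℝ V V ℝ).toContinuousLinearEquiv.toContinuousLinearMap.comp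
        D.flip)

@[simp]
theorem koszulForm_apply {V : Type*} [NormedAddCommGroup V] [NormedSpace ℝ V]
    (D : V →L[ℝ] V →L[ℝ] V →L[ℝ] ℝ) (a b c : V) :
    koszulForm D a b c = 1 / 2 * (D a b c + D b a c - D c a b) := by
  simp [koszulForm]

/-! Tensor fields on a manifold `N` without boundary, modelled on the real vector space `V`. -/

section Manifold

variable {V : Type*} [NormedAddCommGroup V] [NormedSpace ℝ V]
  {H : Type*} [TopologicalSpace H] (I : ModelWithCorners ℝ V H)
  (N : Type*) [TopologicalSpace N] [ChartedSpace H N]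

/-- Fields of bilinear forms on the tangent spaces: tensor fields of type `(0,2)`, no regularity. -/
abbrev BilinField : Type _ :=
  ∀ p : N, TangentSpace I p →L[ℝ] TangentSpace I p →L[ℝ] ℝ

/-- Fields of endomorphisms of the tangent spaces: tensor fields of type `(1,1)`, no regularity. -/
abbrev EndoField : Type _ :=
  ∀ p : N, TangentSpace I p →L[ℝ] TangentSpace I p

variable {I N}

/-- `g` is a pseudo-Riemannian metric: a smooth field of symmetric nondegenerate bilinear forms,
of any signature. -/
structure IsPseudoRiemannianMetric [IsManifold I 1 N] (g : BilinField I N) : Prop where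
  smooth : ContMDiff I (I.prod 𝓘(ℝ, V →L[ℝ] V →L[ℝ] ℝ)) ∞
    (fun p : N ↦ (TotalSpace.mk' (V →L[ℝ] V →L[ℝ] ℝ) p (g p) :
      TotalSpace (V →L[ℝ] V →L[ℝ] ℝ)
        (fun p : N ↦ TangentSpace I p →L[ℝ] TangentSpace I p →L[ℝ] ℝ)))
  symm : ∀ (p : N) (v w : TangentSpace I p), g p v w = g p w v
  nondegenerate : ∀ (p : N) (v : TangentSpace I p), (∀ w : TangentSpace I p, g p v w = 0) → v = 0

/-- `J` is an almost complex structure: a smooth field of endomorphisms with `J² = -1`. -/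
structure IsAlmostComplexStructure [IsManifold I 1 N] (J : EndoField I N) : Prop where
  smooth : ContMDiff I (I.prod 𝓘(ℝ, V →L[ℝ] V)) ∞
    (fun p : N ↦ (TotalSpace.mk' (V →L[ℝ] V) p (J p) :
      TotalSpace (V →L[ℝ] V) (fun p : N ↦ TangentSpace I p →L[ℝ] TangentSpace I p)))
  sq_eq_neg : ∀ (p : N) (v : TangentSpace I p), J p (J p v) = -v

/-- `(N, J, g, g̃)`, with the associated metric `g̃ = g(·, J·)`, is an almost skew-Hermitian
manifold: `J` is almost complex and an anti-isometry of the metric `g`. (Both metrics then have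
neutral signature.) -/
structure IsAlmostSkewHermitian [IsManifold I 1 N] (J : EndoField I N) (g : BilinField I N) :
    Prop where
  metric : IsPseudoRiemannianMetric g
  almostComplex : IsAlmostComplexStructure J
  antiIsometry : ∀ (p : N) (v w : TangentSpace I p), g p (J p v) (J p w) = -g p v w

/-- `(N, J, g)` is an almost Hermitian manifold, `g` of any signature: `J` is almost complex and
an isometry of the metric `g`. -/
structure IsAlmostHermitian [IsManifold I 1 N] (J : EndoField I N) (g : BilinField I N) :
    Prop where
  metric : IsPseudoRiemannianMetric g
  almostComplex : IsAlmostComplexStructure J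
  isometry : ∀ (p : N) (v w : TangentSpace I p), g p (J p v) (J p w) = g p v w

/-- The Kähler form `Φ = g(J·, ·)`. -/
def kaehlerForm (J : EndoField I N) (g : BilinField I N) : BilinField I N :=
  fun p ↦ (g p).comp (J p)

/-! ### Components in charts

The preferred chart at `p` is `φ = extChartAt I p`; the point with coordinates `y` is `φ⁻¹ y`. The
tangent space at `p` is, by definition, `V`, a tangent vector at `p` being the vector of its
components in the preferred chart at `p`. So an expression built from components and their
derivatives in that chart, at `y = φ p`, is directly an expression in tangent vectors at `p`. -/

/-- The coordinate frame of the preferred chart at `p`, at the point with coordinates `y`: the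
derivative of the inverse chart, which maps `a : V` to the tangent vector with components `a`. -/
def chartFrame (p : N) (y : V) : V →L[ℝ] TangentSpace I ((extChartAt I p).symm y) :=
  mfderiv 𝓘(ℝ, V) I (extChartAt I p).symm y

/-- Components of a tangent vector at `φ⁻¹ y` in the preferred chart `φ` at `p`. -/
def chartCoframe (p : N) (y : V) : TangentSpace I ((extChartAt I p).symm y) →L[ℝ] V :=
  mfderiv I 𝓘(ℝ, V) (extChartAt I p) ((extChartAt I p).symm y)

/-- Components `B_ij(y)` of a field of bilinear forms in the preferred chart at `p`. -/
def coordForm (B : BilinField I N) (p : N) (y : V) : V →L[ℝ] V →L[ℝ] ℝ :=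
  pullForm (B ((extChartAt I p).symm y)) (chartFrame p y)

/-- Components `A^i_j(y)` of a field of endomorphisms in the preferred chart at `p`. -/
def coordEndo (A : EndoField I N) (p : N) (y : V) : V →L[ℝ] V :=
  (chartCoframe p y).comp ((A ((extChartAt I p).symm y)).comp (chartFrame p y))

/-- A field `Φ` of alternating forms is closed: `dΦ = 0`, where in coordinates
`(dΦ)(a,b,c) = ∂_a Φ(b,c) + ∂_b Φ(c,a) + ∂_c Φ(a,b)`. -/
def IsClosedForm (B : BilinField I N) : Prop :=
  ∀ (p : N) (a b c : V),
    fderiv ℝ (coordForm B p) (extChartAt I p p) a b c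
      + fderiv ℝ (coordForm B p) (extChartAt I p p) b c a
      + fderiv ℝ (coordForm B p) (extChartAt I p p) c a b = 0

/-- Christoffel symbols of the first kind of `g` in the preferred chart at `p`. -/
def christoffelLower (g : BilinField I N) (p : N) (y : V) : V →L[ℝ] V →L[ℝ] V →L[ℝ] ℝ :=
  koszulForm (fderiv ℝ (coordForm g p) y)

/-- `Γ(a,b,c) = ½ (∂_a g(b,c) + ∂_b g(a,c) - ∂_c g(a,b))`. -/
theorem christoffelLower_apply (g : BilinField I N) (p : N) (y a b c : V) :
    christoffelLower g p y a b c = 1 / 2 * (fderiv ℝ (coordForm g p) y a b c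
      + fderiv ℝ (coordForm g p) y b a c - fderiv ℝ (coordForm g p) y c a b) := by
  simp only [christoffelLower, koszulForm_apply]

/-- Christoffel symbols of the second kind `Γ(a,b)^k = Γ^k_ij a^i b^j` of the Levi-Civita
connection of `g`, in the preferred chart at `p`, at the point with coordinates `y`: the index of
`christoffelLower` is raised by the inverse of `g`. -/
def christoffel (g : BilinField I N) (p : N) (y : V) : V →L[ℝ] V →L[ℝ] V :=
  (ContinuousLinearMap.compL ℝ V (V →L[ℝ] ℝ) V (coordForm g p y).inverse).comp
    (christoffelLower g p y)

theorem christoffel_apply (g : BilinField I N) (p : N) (y a b : V) :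
    christoffel g p y a b = (coordForm g p y).inverse (christoffelLower g p y a b) := rfl

/-- `Γ(a,b)` is the vector with `g(Γ(a,b), c) = Γ(a,b,c)`. -/
theorem coordForm_christoffel [FiniteDimensional ℝ V] (g : BilinField I N) (p : N) (y : V)
    (hg : ∀ a : V, (∀ b : V, coordForm g p y a b = 0) → a = 0) (a b c : V) :
    coordForm g p y (christoffel g p y a b) c = christoffelLower g p y a b c := by
  have hinj : Function.Injective (coordForm g p y) := by
    rw [injective_iff_map_eq_zero]
    intro a ha
    exact hg a fun b ↦ by rw [ha]; rfl
  have hfin : Module.finrank ℝ V = Module.finrank ℝ (V →L[ℝ] ℝ) := by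
    rw [← (LinearMap.toContinuousLinearMap (𝕜 := ℝ) (E := V) (F' := ℝ)).finrank_eq]
    exact (Subspace.dual_finrank_eq (K := ℝ) (V := V)).symm
  let e : V ≃L[ℝ] (V →L[ℝ] ℝ) :=
    (LinearEquiv.ofInjectiveOfFinrankEq (coordForm g p y).toLinearMap hinj
      hfin).toContinuousLinearEquiv
  have he : (e : V →L[ℝ] (V →L[ℝ] ℝ)) = coordForm g p y := by
    ext; rfl
  rw [christoffel_apply, ← he, ContinuousLinearMap.inverse_equiv]
  simp

/-- The covariant derivative of `A` with respect to the Levi-Civita connection of `g`, at `p`: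
`(∇_a A) b = (∂_a A) b + Γ(a, A b) - A (Γ(a, b))`. -/
def nablaEndo (g : BilinField I N) (A : EndoField I N) (p : N) (a b : V) : V :=
  fderiv ℝ (coordEndo A p) (extChartAt I p p) a b
    + christoffel g p (extChartAt I p p) a (coordEndo A p (extChartAt I p p) b)
    - coordEndo A p (extChartAt I p p) (christoffel g p (extChartAt I p p) a b)

/-- The curvature tensor `R(a,b)c` of the Levi-Civita connection `∇` of `g`, at `p`, where
`R = [∇, ∇] - ∇_[ , ]`; in coordinates
`R(a,b)c = ∂_a Γ(b,c) - ∂_b Γ(a,c) + Γ(a, Γ(b,c)) - Γ(b, Γ(a,c))`. -/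
def curvature (g : BilinField I N) (p : N) (a b c : V) : V :=
  fderiv ℝ (christoffel g p) (extChartAt I p p) a b c
    - fderiv ℝ (christoffel g p) (extChartAt I p p) b a c
    + christoffel g p (extChartAt I p p) a (christoffel g p (extChartAt I p p) b c)
    - christoffel g p (extChartAt I p p) b (christoffel g p (extChartAt I p p) a c)

/-- `(N, g)` is flat: its curvature tensor vanishes. -/
def IsFlat (g : BilinField I N) : Prop :=
  ∀ (p : N) (a b c : V), curvature g p a b c = 0

/-- `(N, J, g)` is an almost Kähler manifold: almost Hermitian with closed Kähler form. -/
structure IsAlmostKaehler [IsManifold I 1 N] (J : EndoField I N) (g : BilinField I N) :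
    Prop where
  almostHermitian : IsAlmostHermitian J g
  closed : IsClosedForm (kaehlerForm J g)

/-- `(N, J, g)` is a Kähler manifold: almost Hermitian with `J` parallel with respect to the
Levi-Civita connection, `∇ J = 0`. -/
structure IsKaehler [IsManifold I 1 N] (J : EndoField I N) (g : BilinField I N) : Prop where
  almostHermitian : IsAlmostHermitian J g
  parallel : ∀ (p : N) (a b : V), nablaEndo g J p a b = 0

end Manifold

/-! ### The tangent bundle

A point `u` of `TM` is a pair `⟨p, y⟩` with `y ∈ T_p M`. The preferred chart of `TM` at `u` is given
by the induced coordinates `(x, y)` of the preferred chart of `M` at `p`. So a tangent vector to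
`TM` at `u` is the pair `(ẋ, ẏ) : E × E` of its components in the induced coordinates. -/

section TangentBundle

variable {E : Type*} [NormedAddCommGroup E] [NormedSpace ℝ E]
  {M : Type*} [TopologicalSpace M] [ChartedSpace E M] [IsManifold 𝓘(ℝ, E) ∞ M]

/-- `Γ(·, ·)` at the point `p` in the preferred chart at `p`. -/
def christoffelAt (g : BilinField 𝓘(ℝ, E) M) (p : M) : E →L[ℝ] E →L[ℝ] E :=
  christoffel g p (extChartAt 𝓘(ℝ, E) p p)

/-- The vertical lift to `u` of a tangent vector at `π u`, with components `(0, X)`. -/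
def verticalLift (u : TangentBundle 𝓘(ℝ, E) M) :
    TangentSpace 𝓘(ℝ, E) u.proj →L[ℝ] TangentSpace 𝓘(ℝ, E).tangent u :=
  ContinuousLinearMap.inr ℝ E E

/-- The horizontal lift to `u = ⟨p, y⟩` of a tangent vector at `p`, with respect to the Levi-Civita
connection of `g`; it has components `(X, -Γ(y, X))`. -/
def horizontalLift (g : BilinField 𝓘(ℝ, E) M) (u : TangentBundle 𝓘(ℝ, E) M) :
    TangentSpace 𝓘(ℝ, E) u.proj →L[ℝ] TangentSpace 𝓘(ℝ, E).tangent u :=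
  (ContinuousLinearMap.id ℝ E).prod (-(christoffelAt g u.proj u.snd))

/-- The vector at `π u` whose horizontal lift is the horizontal part of a tangent vector at `u`. -/
def horizontalPart (u : TangentBundle 𝓘(ℝ, E) M) :
    TangentSpace 𝓘(ℝ, E).tangent u →L[ℝ] TangentSpace 𝓘(ℝ, E) u.proj :=
  ContinuousLinearMap.fst ℝ E E

/-- The vector at `π u` whose vertical lift is the vertical part of a tangent vector at `u`. -/
def verticalPart (g : BilinField 𝓘(ℝ, E) M) (u : TangentBundle 𝓘(ℝ, E) M) :
    TangentSpace 𝓘(ℝ, E).tangent u →L[ℝ] TangentSpace 𝓘(ℝ, E) u.proj :=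
  ContinuousLinearMap.snd ℝ E E
    + (christoffelAt g u.proj u.snd).comp (ContinuousLinearMap.fst ℝ E E)

variable (g : BilinField 𝓘(ℝ, E) M) (u : TangentBundle 𝓘(ℝ, E) M)

@[simp]
theorem horizontalPart_horizontalLift (X : TangentSpace 𝓘(ℝ, E) u.proj) :
    horizontalPart u (horizontalLift g u X) = X := rfl

@[simp]
theorem horizontalPart_verticalLift (X : TangentSpace 𝓘(ℝ, E) u.proj) :
    horizontalPart u (verticalLift u X) = 0 := rfl

@[simp]
theorem verticalPart_horizontalLift (X : TangentSpace 𝓘(ℝ, E) u.proj) :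
    verticalPart g u (horizontalLift g u X) = 0 :=
  neg_add_cancel (christoffelAt g u.proj u.snd X)

@[simp]
theorem verticalPart_verticalLift (X : TangentSpace 𝓘(ℝ, E) u.proj) :
    verticalPart g u (verticalLift u X) = X := by
  have h : ∀ x : E, x + christoffelAt g u.proj u.snd 0 = x := by simp
  exact h X

/-- The horizontal and vertical lifts span: every tangent vector to `TM` is `X^H + Y^V`. -/
theorem horizontalLift_add_verticalLift (ξ : TangentSpace 𝓘(ℝ, E).tangent u) :
    horizontalLift g u (horizontalPart u ξ) + verticalLift u (verticalPart g u ξ) = ξ := by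
  obtain ⟨a, b⟩ := (ξ : E × E)
  change ((a + 0, -(christoffelAt g u.proj u.snd a) + (b + christoffelAt g u.proj u.snd a))
    : E × E) = (a, b)
  simp

/-- The almost complex structure `J₁` of `TM`: `X^H ↦ X^V`, `X^V ↦ -X^H`. -/
def tangentJ₁ (g : BilinField 𝓘(ℝ, E) M) :
    EndoField 𝓘(ℝ, E).tangent (TangentBundle 𝓘(ℝ, E) M) := fun u ↦
  (verticalLift u).comp (horizontalPart u) - (horizontalLift g u).comp (verticalPart g u)

/-- The Sasaki metric `ĝ` of `TM`, the diagonal lift of `g`: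
`ĝ(X^H, Y^H) = ĝ(X^V, Y^V) = g(X, Y)` and `ĝ(X^H, Y^V) = 0`. -/
def sasakiMetric (g : BilinField 𝓘(ℝ, E) M) :
    BilinField 𝓘(ℝ, E).tangent (TangentBundle 𝓘(ℝ, E) M) := fun u ↦
  pullForm (g u.proj) (horizontalPart u) + pullForm (g u.proj) (verticalPart g u)

theorem tangentJ₁_horizontalLift (X : TangentSpace 𝓘(ℝ, E) u.proj) :
    tangentJ₁ g u (horizontalLift g u X) = verticalLift u X := by
  simp [tangentJ₁]

theorem tangentJ₁_verticalLift (X : TangentSpace 𝓘(ℝ, E) u.proj) :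
    tangentJ₁ g u (verticalLift u X) = -horizontalLift g u X := by
  simp [tangentJ₁]

theorem sasakiMetric_horizontal_horizontal (X Y : TangentSpace 𝓘(ℝ, E) u.proj) :
    sasakiMetric g u (horizontalLift g u X) (horizontalLift g u Y) = g u.proj X Y := by
  simp [sasakiMetric]

theorem sasakiMetric_vertical_vertical (X Y : TangentSpace 𝓘(ℝ, E) u.proj) :
    sasakiMetric g u (verticalLift u X) (verticalLift u Y) = g u.proj X Y := by
  simp [sasakiMetric]

theorem sasakiMetric_horizontal_vertical (X Y : TangentSpace 𝓘(ℝ, E) u.proj) :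
    sasakiMetric g u (horizontalLift g u X) (verticalLift u Y) = 0 := by
  simp [sasakiMetric]

end TangentBundle

end SasakiTangent

end

namespace SasakiTangent

noncomputable section

open Filter Topology

/-! ### Calculus of fields of bilinear forms and endomorphisms on a vector space -/

section Calculus

variable {V : Type*} [NormedAddCommGroup V] [NormedSpace ℝ V]

/-! In induced coordinates `(x, y)` a tangent vector `ξ` of `TM` has horizontal part `ξ.1` and
vertical part `ξ.2 + Γ(y, ξ.1)`. In terms of these two parts `J₁` is the rotation `(h, v) ↦ (-v, h)`
and `ĝ` is `g ⊕ g`, so the algebraic axioms are immediate. That these coordinate formulas hold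
throughout a chart, and not only at its centre, is the transformation law of the Christoffel
symbols: its inhomogeneous term is exactly the second-derivative term in the induced change of
coordinates (`leviCivita_transform`, `verticalPart_chartFrame`).

The Kähler form is `-dθ` for `θ = g(y, dx)`: by the Koszul formula the Christoffel symbols enter it
only with lowered index, antisymmetrized (`sasakiCoord_tangentJCoord`). Symmetry of the second
derivatives of `g` then gives `dΦ = 0`.

When `dΦ = 0`, the classical formula `2 ĝ((∇_a J) b, c) = -ĝ(J N(b, c), a)` shows that `∇J = 0` is
equivalent to the vanishing of the Nijenhuis tensor `N` (`nablaCoord_koszul`). Vertical vectors and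
their images under `J₁` span, and `N(J b, c) = -J N(b, c)`, so `N` needs to be known on vertical
vectors only. There `N(b^V, c^V) = -(R(b, c) y)^V` at the point `(x, y)`
(`nijenhuisCoord_tangentJCoord`). Since `y` is an arbitrary tangent vector, `N = 0` on all of `TM`
means `R = 0`. -/

theorem exists_continuousLinearEquiv_of_nondegenerate [FiniteDimensional ℝ V]
    (B : V →L[ℝ] V →L[ℝ] ℝ) (hB : ∀ a : V, (∀ b : V, B a b = 0) → a = 0) :
    ∃ e : V ≃L[ℝ] (V →L[ℝ] ℝ), (e : V →L[ℝ] (V →L[ℝ] ℝ)) = B := by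
  have hinj : Function.Injective B := by
    rw [injective_iff_map_eq_zero]
    intro a ha
    exact hB a fun b ↦ by rw [ha]; rfl
  have hfin : Module.finrank ℝ V = Module.finrank ℝ (V →L[ℝ] ℝ) := by
    rw [← (LinearMap.toContinuousLinearMap (𝕜 := ℝ) (E := V) (F' := ℝ)).finrank_eq]
    exact (Subspace.dual_finrank_eq (K := ℝ) (V := V)).symm
  exact ⟨(LinearEquiv.ofInjectiveOfFinrankEq B.toLinearMap hinj
    hfin).toContinuousLinearEquiv, by ext; rfl⟩

/-- The Christoffel symbols of the second kind of a field of bilinear forms on a vector space. -/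
def leviCivita (G : V → V →L[ℝ] V →L[ℝ] ℝ) (x : V) : V →L[ℝ] V →L[ℝ] V :=
  (ContinuousLinearMap.compL ℝ V (V →L[ℝ] ℝ) V (G x).inverse).comp (koszulForm (fderiv ℝ G x))

/-- `(∇_a A) b`, computed in a vector space. -/
def nablaCoord (G : V → V →L[ℝ] V →L[ℝ] ℝ) (A : V → V →L[ℝ] V) (x a b : V) : V :=
  fderiv ℝ A x a b + leviCivita G x a (A x b) - A x (leviCivita G x a b)

/-- The value of the Nijenhuis tensor of `A` on constant vector fields. -/
def nijenhuisCoord (A : V → V →L[ℝ] V) (x a b : V) : V :=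
  fderiv ℝ A x (A x a) b - fderiv ℝ A x (A x b) a
    - A x (fderiv ℝ A x a b) + A x (fderiv ℝ A x b a)

variable {G : V → V →L[ℝ] V →L[ℝ] ℝ} {A : V → V →L[ℝ] V} {x : V}

theorem leviCivita_spec [FiniteDimensional ℝ V]
    (hG : ∀ a : V, (∀ b : V, G x a b = 0) → a = 0) (a b c : V) :
    G x (leviCivita G x a b) c = koszulForm (fderiv ℝ G x) a b c := by
  -- `inverse` is zero on maps that are not invertible; nondegeneracy in finite dimension makes `G
  -- x` an equivalence onto the dual.
  obtain ⟨e, he⟩ := exists_continuousLinearEquiv_of_nondegenerate (G x) hG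
  change G x ((G x).inverse (koszulForm (fderiv ℝ G x) a b)) c = _
  rw [← he, ContinuousLinearMap.inverse_equiv]
  simp

theorem leviCivita_congr {G' : V → V →L[ℝ] V →L[ℝ] ℝ} (h : G =ᶠ[𝓝 x] G') :
    leviCivita G x = leviCivita G' x := by
  rw [leviCivita, leviCivita, h.fderiv_eq, h.self_of_nhds]

theorem fderiv_clm_apply_const {V' W W' : Type*} [NormedAddCommGroup V'] [NormedSpace ℝ V']
    [NormedAddCommGroup W] [NormedSpace ℝ W]
    [NormedAddCommGroup W'] [NormedSpace ℝ W'] {f : V' → W →L[ℝ] W'} {x : V'}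
    (hf : DifferentiableAt ℝ f x) (a : V') (b : W) :
    fderiv ℝ (fun y ↦ f y b) x a = fderiv ℝ f x a b := by
  rw [fderiv_clm_apply hf (differentiableAt_const b)]
  simp

theorem fderiv_form_apply {V' : Type*} [NormedAddCommGroup V'] [NormedSpace ℝ V']
    {B : V' → V →L[ℝ] V →L[ℝ] ℝ} {x : V'} {u v : V' → V} (hB : DifferentiableAt ℝ B x)
    (hu : DifferentiableAt ℝ u x) (hv : DifferentiableAt ℝ v x) (a : V') :
    fderiv ℝ (fun y ↦ B y (u y) (v y)) x a =
      fderiv ℝ B x a (u x) (v x) + B x (fderiv ℝ u x a) (v x) + B x (u x) (fderiv ℝ v x a) := by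
  rw [fderiv_clm_apply (hB.clm_apply hu) hv, fderiv_clm_apply hB hu]
  simp
  ring

theorem fderiv_form_symm (hG : DifferentiableAt ℝ G x)
    (hs : ∀ᶠ y in 𝓝 x, ∀ a b : V, G y a b = G y b a) (a b c : V) :
    fderiv ℝ G x a b c = fderiv ℝ G x a c b := by
  have h : (fun y ↦ G y b c) =ᶠ[𝓝 x] fun y ↦ G y c b := hs.mono fun y hy ↦ hy b c
  have := congrArg (fun L : V →L[ℝ] ℝ ↦ L a) h.fderiv_eq
  simpa [fderiv_form_apply hG (differentiableAt_const _) (differentiableAt_const _)] using this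

theorem leviCivita_symm (hG : DifferentiableAt ℝ G x)
    (hs : ∀ᶠ y in 𝓝 x, ∀ a b : V, G y a b = G y b a) (a b : V) :
    leviCivita G x a b = leviCivita G x b a := by
  have h : koszulForm (fderiv ℝ G x) a b = koszulForm (fderiv ℝ G x) b a := by
    ext c
    rw [koszulForm_apply, koszulForm_apply, fderiv_form_symm hG hs c a b]
    ring
  exact congrArg (G x).inverse h

theorem contDiffAt_koszulForm {D : V → V →L[ℝ] V →L[ℝ] V →L[ℝ] ℝ} (hD : ContDiffAt ℝ ∞ D x) :
    ContDiffAt ℝ ∞ (fun y ↦ koszulForm (D y)) x := by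
  have hflip : ContDiffAt ℝ ∞ (fun y ↦ (D y).flip) x :=
    (ContinuousLinearMap.flipₗᵢ ℝ V V (V →L[ℝ] ℝ)).toContinuousLinearEquiv.contDiff.contDiffAt.comp
      x hD
  have hcomp : ContDiffAt ℝ ∞ (fun y ↦
      ((ContinuousLinearMap.flipₗᵢ ℝ V V ℝ).toContinuousLinearEquiv.toContinuousLinearMap).comp
        (D y).flip) x := contDiffAt_const.clm_comp hflip
  exact ((hD.add hflip).sub hcomp).const_smul (1 / 2 : ℝ)

/-- Inversion of continuous linear maps is smooth at an equivalence, so nondegeneracy at the single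
point `x` is enough. -/
theorem contDiffAt_leviCivita [FiniteDimensional ℝ V]
    (hG : ∀ a : V, (∀ b : V, G x a b = 0) → a = 0) (h : ContDiffAt ℝ ∞ G x) :
    ContDiffAt ℝ ∞ (leviCivita G) x := by
  obtain ⟨e, he⟩ := exists_continuousLinearEquiv_of_nondegenerate (G x) hG
  have : CompleteSpace V := FiniteDimensional.complete ℝ V
  have hinv : ContDiffAt ℝ ∞ (fun y ↦ (G y).inverse) x := by
    have := contDiffAt_map_inverse (𝕜 := ℝ) (n := ∞) e
    rw [he] at this
    exact this.comp x h
  have hk := contDiffAt_koszulForm (h.fderiv_right (m := ∞) le_rfl)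
  exact ((ContinuousLinearMap.compL ℝ V (V →L[ℝ] ℝ) V).contDiff.contDiffAt.comp x hinv).clm_comp hk

/-- The transformation law of the Christoffel symbols under a change of coordinates. -/
theorem leviCivita_transform [FiniteDimensional ℝ V] {G' : V → V →L[ℝ] V →L[ℝ] ℝ} {ψ : V → V}
    (hψ : ContDiffAt ℝ ∞ ψ x) (hG' : DifferentiableAt ℝ G' (ψ x))
    (hs : ∀ᶠ y in 𝓝 (ψ x), ∀ a b : V, G' y a b = G' y b a)
    (hG'n : ∀ a : V, (∀ b : V, G' (ψ x) a b = 0) → a = 0)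
    (hGn : ∀ a : V, (∀ b : V, G x a b = 0) → a = 0)
    (hG : ∀ᶠ y in 𝓝 x, ∀ a b : V, G y a b = G' (ψ y) (fderiv ℝ ψ y a) (fderiv ℝ ψ y b))
    (hGd : DifferentiableAt ℝ G x)
    (hsurj : Function.Surjective (fderiv ℝ ψ x)) (a b : V) :
    fderiv ℝ ψ x (leviCivita G x a b) =
      fderiv ℝ (fderiv ℝ ψ) x a b + leviCivita G' (ψ x) (fderiv ℝ ψ x a) (fderiv ℝ ψ x b) := by
  have hψ1 : DifferentiableAt ℝ ψ x := hψ.differentiableAt (by simp)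
  have hψ2 : DifferentiableAt ℝ (fderiv ℝ ψ) x :=
    (hψ.fderiv_right (m := ∞) le_rfl).differentiableAt (by simp)
  have hsym : ∀ a b, fderiv ℝ (fderiv ℝ ψ) x a b = fderiv ℝ (fderiv ℝ ψ) x b a :=
    fun a b ↦ (hψ.isSymmSndFDerivAt (by simpa using WithTop.coe_le_coe.2 (le_top : (2 : ℕ∞) ≤ ⊤))).eq a b
  have hG's := hs.self_of_nhds
  have hD (a b c : V) : fderiv ℝ G x a b c =
      fderiv ℝ G' (ψ x) (fderiv ℝ ψ x a) (fderiv ℝ ψ x b) (fderiv ℝ ψ x c)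
        + G' (ψ x) (fderiv ℝ (fderiv ℝ ψ) x a b) (fderiv ℝ ψ x c)
        + G' (ψ x) (fderiv ℝ ψ x b) (fderiv ℝ (fderiv ℝ ψ) x a c) := by
    have h : (fun y ↦ G y b c) =ᶠ[𝓝 x]
        fun y ↦ G' (ψ y) (fderiv ℝ ψ y b) (fderiv ℝ ψ y c) := hG.mono fun y hy ↦ hy b c
    have := congrArg (fun L : V →L[ℝ] ℝ ↦ L a) h.fderiv_eq
    have hcomp : DifferentiableAt ℝ (fun y ↦ G' (ψ y)) x := hG'.comp x hψ1
    rw [fderiv_form_apply hGd (differentiableAt_const _) (differentiableAt_const _),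
      fderiv_form_apply hcomp (hψ2.clm_apply (differentiableAt_const _))
        (hψ2.clm_apply (differentiableAt_const _)), fderiv_clm_apply_const hψ2,
      fderiv_clm_apply_const hψ2, fderiv_fun_comp x hG' hψ1] at this
    simpa using this
  rw [← sub_eq_zero]
  refine hG'n _ fun c' ↦ ?_
  obtain ⟨c, rfl⟩ := hsurj c'
  -- In the Koszul combination the symmetric second derivatives of `ψ` cancel, except for `G'(D²ψ(a,
  -- b), Dψ c)`.
  rw [map_sub, map_add, sub_apply, add_apply,
    leviCivita_spec hG'n, ← hG.self_of_nhds, leviCivita_spec hGn, koszulForm_apply,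
    koszulForm_apply, hD, hD, hD, hsym b a, hsym c a, hsym c b,
    hG's (fderiv ℝ ψ x a) (fderiv ℝ (fderiv ℝ ψ) x b c),
    hG's (fderiv ℝ ψ x b) (fderiv ℝ (fderiv ℝ ψ) x a c)]
  ring

/-- The Koszul-type formula expressing `∇ A` by `dΦ` and the Nijenhuis tensor. -/
theorem koszul_nabla_identity (B : V →L[ℝ] V →L[ℝ] ℝ) (J : V →L[ℝ] V)
    (D : V →L[ℝ] V →L[ℝ] V →L[ℝ] ℝ) (J' : V →L[ℝ] V →L[ℝ] V)
    (hB : ∀ a b, B a b = B b a) (hJ : ∀ a, J (J a) = -a) (hBJ : ∀ a b, B (J a) (J b) = B a b)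
    (hD : ∀ a b c, D a b c = D a c b) (hJ' : ∀ a b, J' a (J b) = -J (J' a b))
    (hDJ : ∀ a b c, D a (J b) (J c) + B (J' a b) (J c) + B (J b) (J' a c) = D a b c)
    (hcl : ∀ a b c, (D a (J b) c + B (J' a b) c) + (D b (J c) a + B (J' b c) a)
      + (D c (J a) b + B (J' c a) b) = 0) (a b c : V) :
    2 * (B (J' a b) c + koszulForm D a (J b) c + koszulForm D a b (J c)) =
      -B (J (J' (J b) c - J' (J c) b - J (J' b c) + J (J' c b))) a := by
  -- The derivative of `Φ` is skew in its two arguments: put `J v` for `v` in the differentiated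
  -- isometry condition.
  have hΦ (u v w : V) : D u (J v) w + B (J' u v) w = -(D u (J w) v + B (J' u w) v) := by
    have h := hDJ u (J v) w
    simp only [hJ, hJ', map_neg, neg_apply, hBJ] at h
    rw [hD u (J w) v, hB (J' u w) v]
    linarith
  -- The two instances of `dΦ = 0` that matter are `(a, b, c)` and `(a, J b, J c)`.
  have h1 := hcl a b c
  have h2 := hcl a (J b) (J c)
  have h3 := hΦ c a b
  have h4 := hΦ (J c) a (J b)
  have h5 := hΦ a b c
  simp only [koszulForm_apply, hJ, hJ', map_neg, map_add, map_sub, neg_apply, add_apply,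
    sub_apply, hBJ] at *
  rw [hD (J b) a c, hD c a (J b), hD b a (J c), hD (J c) a b]
  linarith [hD a b (J c)]

end Calculus

/-! ### Almost Hermitian structures in coordinates -/

section AlmostHermitian

variable {V : Type*} [NormedAddCommGroup V] [NormedSpace ℝ V]
  {G : V → V →L[ℝ] V →L[ℝ] ℝ} {A : V → V →L[ℝ] V} {x : V}

theorem fderiv_endo_apply (hA : DifferentiableAt ℝ A x) (hJ : ∀ᶠ y in 𝓝 x, ∀ a, A y (A y a) = -a)
    (a b : V) : fderiv ℝ A x a (A x b) = -A x (fderiv ℝ A x a b) := by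
  have h : (fun y ↦ A y (A y b)) =ᶠ[𝓝 x] fun _ ↦ -b := hJ.mono fun y hy ↦ hy b
  have := congrArg (fun L : V →L[ℝ] V ↦ L a) h.fderiv_eq
  rw [fderiv_clm_apply hA (hA.clm_apply (differentiableAt_const _))] at this
  have h' : A x (fderiv ℝ A x a b) + fderiv ℝ A x a (A x b) = 0 := by
    simpa [fderiv_clm_apply_const hA] using this
  exact eq_neg_of_add_eq_zero_right h'

/-- Differentiating `J² = -1`, the symmetry of `G` and the isometry condition produces the pointwise
relations of `koszul_nabla_identity`; lowering the index turns `∇` into Koszul forms. -/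
theorem nablaCoord_koszul [FiniteDimensional ℝ V] (hG : DifferentiableAt ℝ G x)
    (hA : DifferentiableAt ℝ A x)
    (hn : ∀ a : V, (∀ b : V, G x a b = 0) → a = 0)
    (hs : ∀ᶠ y in 𝓝 x, ∀ a b : V, G y a b = G y b a)
    (hJ : ∀ᶠ y in 𝓝 x, ∀ a, A y (A y a) = -a)
    (hGJ : ∀ᶠ y in 𝓝 x, ∀ a b : V, G y (A y a) (A y b) = G y a b)
    (hcl : ∀ a b c : V, fderiv ℝ (fun y ↦ (G y).comp (A y)) x a b c
      + fderiv ℝ (fun y ↦ (G y).comp (A y)) x b c a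
      + fderiv ℝ (fun y ↦ (G y).comp (A y)) x c a b = 0) (a b c : V) :
    2 * G x (nablaCoord G A x a b) c = -G x (A x (nijenhuisCoord A x b c)) a := by
  have hskew (u v : V) : G x (A x u) v = -G x u (A x v) := by
    rw [← hGJ.self_of_nhds u (A x v), hJ.self_of_nhds]; simp
  have hDA (u v : V) : fderiv ℝ (fun y ↦ A y v) x u = fderiv ℝ A x u v :=
    fderiv_clm_apply_const hA u v
  have hΦ (a b c : V) : fderiv ℝ (fun y ↦ (G y).comp (A y)) x a b c =
      fderiv ℝ G x a (A x b) c + G x (fderiv ℝ A x a b) c := by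
    have h1 := fderiv_form_apply (hG.clm_comp hA) (differentiableAt_const b)
      (differentiableAt_const c) a
    have h2 := fderiv_form_apply hG (hA.clm_apply (differentiableAt_const b))
      (differentiableAt_const c) a
    rw [hDA] at h2
    simp only [fderiv_fun_const, Pi.zero_apply, zero_apply, map_zero, add_zero] at h1 h2
    exact h1.symm.trans h2
  have hDJ (a b c : V) : fderiv ℝ G x a (A x b) (A x c) + G x (fderiv ℝ A x a b) (A x c)
      + G x (A x b) (fderiv ℝ A x a c) = fderiv ℝ G x a b c := by
    have h : (fun y ↦ G y (A y b) (A y c)) =ᶠ[𝓝 x] fun y ↦ G y b c := hGJ.mono fun y hy ↦ hy b c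
    have := congrArg (fun L : V →L[ℝ] ℝ ↦ L a) h.fderiv_eq
    rw [fderiv_form_apply hG (differentiableAt_const _) (differentiableAt_const _),
      fderiv_form_apply hG (hA.clm_apply (differentiableAt_const _))
        (hA.clm_apply (differentiableAt_const _)), hDA, hDA] at this
    simpa using this
  have key := koszul_nabla_identity (G x) (A x) (fderiv ℝ G x) (fderiv ℝ A x) hs.self_of_nhds
    hJ.self_of_nhds hGJ.self_of_nhds (fderiv_form_symm hG hs) (fderiv_endo_apply hA hJ) hDJ
    (fun a b c ↦ by rw [← hΦ, ← hΦ, ← hΦ]; exact hcl a b c) a b c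
  rw [nijenhuisCoord, ← key, nablaCoord, map_sub, map_add, sub_apply, add_apply, hskew,
    leviCivita_spec hn, leviCivita_spec hn]
  ring

theorem nablaCoord_eq_zero_iff [FiniteDimensional ℝ V] (hG : DifferentiableAt ℝ G x)
    (hA : DifferentiableAt ℝ A x)
    (hn : ∀ a : V, (∀ b : V, G x a b = 0) → a = 0)
    (hs : ∀ᶠ y in 𝓝 x, ∀ a b : V, G y a b = G y b a)
    (hJ : ∀ᶠ y in 𝓝 x, ∀ a, A y (A y a) = -a)
    (hGJ : ∀ᶠ y in 𝓝 x, ∀ a b : V, G y (A y a) (A y b) = G y a b)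
    (hcl : ∀ a b c : V, fderiv ℝ (fun y ↦ (G y).comp (A y)) x a b c
      + fderiv ℝ (fun y ↦ (G y).comp (A y)) x b c a
      + fderiv ℝ (fun y ↦ (G y).comp (A y)) x c a b = 0) :
    (∀ a b, nablaCoord G A x a b = 0) ↔ ∀ b c, nijenhuisCoord A x b c = 0 := by
  have key := nablaCoord_koszul hG hA hn hs hJ hGJ hcl
  constructor
  · intro h b c
    have h1 : A x (nijenhuisCoord A x b c) = 0 := hn _ fun a ↦ by simpa [h] using key a b c
    have h2 := hJ.self_of_nhds (nijenhuisCoord A x b c)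
    rw [h1, map_zero] at h2
    exact neg_eq_zero.1 h2.symm
  · intro h a b
    exact hn _ fun c ↦ by simpa [h] using key a b c

theorem nijenhuisCoord_antisymm (b c : V) : nijenhuisCoord A x c b = -nijenhuisCoord A x b c := by
  simp only [nijenhuisCoord]
  abel

/-- A consequence of `A² = -1` and of the fact that the derivative of `A` anticommutes with `A`. -/
theorem nijenhuisCoord_apply_left (hA : DifferentiableAt ℝ A x)
    (hJ : ∀ᶠ y in 𝓝 x, ∀ a, A y (A y a) = -a) (b c : V) :
    nijenhuisCoord A x (A x b) c = -A x (nijenhuisCoord A x b c) := by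
  simp only [nijenhuisCoord, fderiv_endo_apply hA hJ, hJ.self_of_nhds, map_neg, neg_apply, map_add,
    map_sub]
  abel

theorem nijenhuisCoord_add_left (b b' c : V) :
    nijenhuisCoord A x (b + b') c = nijenhuisCoord A x b c + nijenhuisCoord A x b' c := by
  simp only [nijenhuisCoord, map_add, add_apply]
  abel

/-- The Nijenhuis tensor vanishes as soon as it vanishes on `S`, where `S + A S` is everything. -/
theorem nijenhuisCoord_eq_zero (hA : DifferentiableAt ℝ A x)
    (hJ : ∀ᶠ y in 𝓝 x, ∀ a, A y (A y a) = -a) (S : Set V)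
    (hS : ∀ v, ∃ s ∈ S, ∃ t ∈ S, v = s + A x t)
    (h : ∀ s ∈ S, ∀ t ∈ S, nijenhuisCoord A x s t = 0) (b c : V) : nijenhuisCoord A x b c = 0 := by
  -- The first argument is freed while the second stays in `S`; antisymmetry then frees the second.
  have h1 (v : V) : ∀ s ∈ S, nijenhuisCoord A x v s = 0 := by
    intro s hs
    obtain ⟨t, ht, r, hr, rfl⟩ := hS v
    rw [nijenhuisCoord_add_left, nijenhuisCoord_apply_left hA hJ, h t ht s hs, h r hr s hs]
    simp
  obtain ⟨t, ht, r, hr, rfl⟩ := hS b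
  rw [nijenhuisCoord_add_left, nijenhuisCoord_apply_left hA hJ, nijenhuisCoord_antisymm,
    nijenhuisCoord_antisymm c r, h1 c t ht, h1 c r hr]
  simp

end AlmostHermitian

/-! ### The lifted structures in induced coordinates -/

section Lift

variable {E : Type*} [NormedAddCommGroup E] [NormedSpace ℝ E]

/-- The almost complex structure `X^H ↦ X^V`, `X^V ↦ -X^H` of `E × E`, where `X^H = (X, -Γ X)`. -/
def liftJ (Γ : E →L[ℝ] E) : E × E →L[ℝ] E × E :=
  (ContinuousLinearMap.inr ℝ E E).comp (ContinuousLinearMap.fst ℝ E E)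
    - ((ContinuousLinearMap.id ℝ E).prod (-Γ)).comp
      (ContinuousLinearMap.snd ℝ E E + Γ.comp (ContinuousLinearMap.fst ℝ E E))

/-- The diagonal lift to `E × E` of a bilinear form on `E`. -/
def liftForm (B : E →L[ℝ] E →L[ℝ] ℝ) (Γ : E →L[ℝ] E) : E × E →L[ℝ] E × E →L[ℝ] ℝ :=
  pullForm B (ContinuousLinearMap.fst ℝ E E)
    + pullForm B (ContinuousLinearMap.snd ℝ E E + Γ.comp (ContinuousLinearMap.fst ℝ E E))

theorem liftJ_apply (Γ : E →L[ℝ] E) (ξ : E × E) :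
    liftJ Γ ξ = (-(ξ.2 + Γ ξ.1), ξ.1 + Γ (ξ.2 + Γ ξ.1)) := by
  ext <;> simp [liftJ]
  abel

theorem liftForm_apply (B : E →L[ℝ] E →L[ℝ] ℝ) (Γ : E →L[ℝ] E) (ξ η : E × E) :
    liftForm B Γ ξ η = B ξ.1 η.1 + B (ξ.2 + Γ ξ.1) (η.2 + Γ η.1) := by
  simp [liftForm]

/-- With `h = ξ.1` and `v = ξ.2 + Γ ξ.1`, `liftJ` is `(h, v) ↦ (-v, h)` and `liftForm` is `B ⊕ B`.
This and the next identities therefore hold for every linear map `Γ`. -/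
theorem liftJ_liftJ (Γ : E →L[ℝ] E) (ξ : E × E) : liftJ Γ (liftJ Γ ξ) = -ξ := by
  rw [liftJ_apply, liftJ_apply]
  ext <;> simp <;> abel

theorem liftForm_liftJ (B : E →L[ℝ] E →L[ℝ] ℝ) (Γ : E →L[ℝ] E) (ξ η : E × E) :
    liftForm B Γ (liftJ Γ ξ) (liftJ Γ η) = liftForm B Γ ξ η := by
  simp only [liftForm_apply, liftJ_apply, map_neg, map_add, neg_apply, add_apply]
  ring

theorem liftForm_symm {B : E →L[ℝ] E →L[ℝ] ℝ} (hB : ∀ a b, B a b = B b a) (Γ : E →L[ℝ] E)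
    (ξ η : E × E) : liftForm B Γ ξ η = liftForm B Γ η ξ := by
  rw [liftForm_apply, liftForm_apply, hB, hB (ξ.2 + _)]

theorem liftForm_nondegenerate {B : E →L[ℝ] E →L[ℝ] ℝ} (hB : ∀ a, (∀ b, B a b = 0) → a = 0)
    (Γ : E →L[ℝ] E) (ξ : E × E) (h : ∀ η, liftForm B Γ ξ η = 0) : ξ = 0 := by
  have h2 : ξ.2 + Γ ξ.1 = 0 := hB _ fun b ↦ by simpa [liftForm_apply] using h (0, b)
  have h1 : ξ.1 = 0 := hB _ fun b ↦ by simpa [liftForm_apply, h2] using h (b, 0)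
  rw [h1, map_zero, add_zero] at h2
  exact Prod.ext h1 h2

/-- The lifted metric in induced coordinates. -/
def sasakiCoord (G : E → E →L[ℝ] E →L[ℝ] ℝ) (z : E × E) : E × E →L[ℝ] E × E →L[ℝ] ℝ :=
  liftForm (G z.1) (leviCivita G z.1 z.2)

/-- The lifted almost complex structure in induced coordinates. -/
def tangentJCoord (G : E → E →L[ℝ] E →L[ℝ] ℝ) (z : E × E) : E × E →L[ℝ] E × E :=
  liftJ (leviCivita G z.1 z.2)

variable [FiniteDimensional ℝ E] {G : E → E →L[ℝ] E →L[ℝ] ℝ} {z : E × E}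

theorem contDiffAt_leviCivita_snd (hn : ∀ a : E, (∀ b : E, G z.1 a b = 0) → a = 0)
    (hG : ContDiffAt ℝ ∞ G z.1) : ContDiffAt ℝ ∞ (fun w : E × E ↦ leviCivita G w.1 w.2) z :=
  ((contDiffAt_leviCivita hn hG).comp z contDiffAt_fst).clm_apply contDiffAt_snd

theorem contDiffAt_tangentJCoord (hn : ∀ a : E, (∀ b : E, G z.1 a b = 0) → a = 0)
    (hG : ContDiffAt ℝ ∞ G z.1) : ContDiffAt ℝ ∞ (tangentJCoord G) z := by
  have hΓ := contDiffAt_leviCivita_snd hn hG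
  have hv : ContDiffAt ℝ ∞ (fun w : E × E ↦ ContinuousLinearMap.snd ℝ E E
      + (leviCivita G w.1 w.2).comp (ContinuousLinearMap.fst ℝ E E)) z :=
    contDiffAt_const.add (hΓ.clm_comp contDiffAt_const)
  have hh : ContDiffAt ℝ ∞ (fun w : E × E ↦
      (ContinuousLinearMap.id ℝ E).prod (-leviCivita G w.1 w.2)) z :=
    (ContinuousLinearMap.prodₗᵢ (𝕜 := ℝ) (E := E) (F := E) (G := E)
      ℝ).toContinuousLinearEquiv.contDiff.contDiffAt.comp z
      ((contDiffAt_const (c := ContinuousLinearMap.id ℝ E)).prodMk hΓ.neg)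
  exact contDiffAt_const.sub (hh.clm_comp hv)

theorem _root_.ContDiffAt.pullForm {F S T : Type*} [NormedAddCommGroup F] [NormedSpace ℝ F]
    [NormedAddCommGroup S] [NormedSpace ℝ S] [NormedAddCommGroup T] [NormedSpace ℝ T]
    {n : WithTop ℕ∞} {B : F → T →L[ℝ] T →L[ℝ] ℝ} {L : F → S →L[ℝ] T} {x : F}
    (hB : ContDiffAt ℝ n B x) (hL : ContDiffAt ℝ n L x) :
    ContDiffAt ℝ n (fun y ↦ SasakiTangent.pullForm (B y) (L y)) x := by
  have hp : ContDiffAt ℝ n (fun y ↦ ContinuousLinearMap.precomp ℝ (L y)) x :=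
    (ContinuousLinearMap.compL ℝ S T ℝ).flip.contDiff.contDiffAt.comp x hL
  exact hp.clm_comp (hB.clm_comp hL)

theorem contDiffAt_sasakiCoord (hn : ∀ a : E, (∀ b : E, G z.1 a b = 0) → a = 0)
    (hG : ContDiffAt ℝ ∞ G z.1) : ContDiffAt ℝ ∞ (sasakiCoord G) z := by
  have hG' : ContDiffAt ℝ ∞ (fun w : E × E ↦ G w.1) z := hG.comp z contDiffAt_fst
  exact (hG'.pullForm contDiffAt_const).add (hG'.pullForm
    (contDiffAt_const.add ((contDiffAt_leviCivita_snd hn hG).clm_comp contDiffAt_const)))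

/-- The lifted Kähler form is `-dθ` for `θ = g(y, dx)`. -/
theorem sasakiCoord_tangentJCoord (hn : ∀ a : E, (∀ b : E, G z.1 a b = 0) → a = 0)
    (hG : DifferentiableAt ℝ G z.1) (hs : ∀ᶠ y in 𝓝 z.1, ∀ a b : E, G y a b = G y b a)
    (ξ η : E × E) : sasakiCoord G z (tangentJCoord G z ξ) η =
      G z.1 ξ.1 η.2 - G z.1 η.1 ξ.2 + fderiv ℝ G z.1 η.1 z.2 ξ.1 - fderiv ℝ G z.1 ξ.1 z.2 η.1 := by
  have h1 := leviCivita_spec hn z.2 η.1 ξ.1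
  have h2 := leviCivita_spec hn z.2 ξ.1 η.1
  rw [koszulForm_apply] at h1 h2
  rw [sasakiCoord, tangentJCoord, liftForm_apply, liftJ_apply]
  simp only [map_neg, add_neg_cancel_right]
  simp only [neg_apply, map_add, add_apply]
  -- In the difference of the Koszul forms at `(y, η.1, ξ.1)` and `(y, ξ.1, η.1)` the derivative of
  -- `G` along `y` drops out.
  rw [hs.self_of_nhds ξ.1, hs.self_of_nhds ξ.1 (leviCivita G z.1 z.2 η.1), h1, h2,
    hs.self_of_nhds ξ.2, fderiv_form_symm hG hs z.2 ξ.1 η.1]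
  ring

/-- In the cyclic sum the second derivatives of `G` cancel because they commute, the first
derivatives because `G` is symmetric. -/
theorem isClosed_sasakiCoord_tangentJCoord
    (hn : ∀ᶠ x in 𝓝 z.1, ∀ a : E, (∀ b : E, G x a b = 0) → a = 0) (hG : ContDiffAt ℝ ∞ G z.1)
    (hs : ∀ᶠ y in 𝓝 z.1, ∀ a b : E, G y a b = G y b a) (ξ η ζ : E × E) :
    fderiv ℝ (fun w ↦ (sasakiCoord G w).comp (tangentJCoord G w)) z ξ η ζ
      + fderiv ℝ (fun w ↦ (sasakiCoord G w).comp (tangentJCoord G w)) z η ζ ξ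
      + fderiv ℝ (fun w ↦ (sasakiCoord G w).comp (tangentJCoord G w)) z ζ ξ η = 0 := by
  have hG1 : DifferentiableAt ℝ G z.1 := hG.differentiableAt (by simp)
  have hG2 : DifferentiableAt ℝ (fderiv ℝ G) z.1 :=
    (hG.fderiv_right (m := ∞) le_rfl).differentiableAt (by simp)
  have hsym : ∀ a b, fderiv ℝ (fderiv ℝ G) z.1 a b = fderiv ℝ (fderiv ℝ G) z.1 b a :=
    fun a b ↦ (hG.isSymmSndFDerivAt
      (by simpa using WithTop.coe_le_coe.2 (le_top : (2 : ℕ∞) ≤ ⊤))).eq a b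
  have hfst : DifferentiableAt ℝ (Prod.fst : E × E → E) z := differentiableAt_fst
  have hev : ∀ᶠ y in 𝓝 z.1, DifferentiableAt ℝ G y := by
    filter_upwards [(hG.of_le (m := 1) (by simp)).eventually (by simp)] with y hy
      using hy.differentiableAt (by simp)
  have hd : DifferentiableAt ℝ (fun w ↦ (sasakiCoord G w).comp (tangentJCoord G w)) z :=
    ((contDiffAt_sasakiCoord hn.self_of_nhds hG).clm_comp
      (contDiffAt_tangentJCoord hn.self_of_nhds hG)).differentiableAt (by simp)
  have hG1' : DifferentiableAt ℝ (fun w : E × E ↦ G w.1) z := hG1.comp z hfst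
  have hG2' : DifferentiableAt ℝ (fun w : E × E ↦ fderiv ℝ G w.1) z := hG2.comp z hfst
  have hD1 (ζ : E × E) : fderiv ℝ (fun w : E × E ↦ G w.1) z ζ = fderiv ℝ G z.1 ζ.1 := by
    rw [fderiv_fun_comp z hG1 hfst, fderiv_fst]; rfl
  have hD2 (ζ : E × E) (a : E) : fderiv ℝ (fun w : E × E ↦ fderiv ℝ G w.1 a) z ζ =
      fderiv ℝ (fderiv ℝ G) z.1 ζ.1 a := by
    rw [fderiv_clm_apply_const hG2', fderiv_fun_comp z hG2 hfst, fderiv_fst]; rfl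
  have hd2 (a b : E) : DifferentiableAt ℝ (fun w : E × E ↦ fderiv ℝ G w.1 a w.2 b) z :=
    ((hG2'.clm_apply (differentiableAt_const a)).clm_apply differentiableAt_snd).clm_apply
      (differentiableAt_const b)
  have hd1 (a b : E) : DifferentiableAt ℝ (fun w : E × E ↦ G w.1 a b) z :=
    (hG1'.clm_apply (differentiableAt_const a)).clm_apply (differentiableAt_const b)
  have hT2 (a b : E) (ζ : E × E) : fderiv ℝ (fun w : E × E ↦ fderiv ℝ G w.1 a w.2 b) z ζ =
      fderiv ℝ (fderiv ℝ G) z.1 ζ.1 a z.2 b + fderiv ℝ G z.1 a ζ.2 b := by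
    rw [fderiv_form_apply (hG2'.clm_apply (differentiableAt_const a)) differentiableAt_snd
      (differentiableAt_const b), hD2, fderiv_snd]
    simp
  have hT1 (a b : E) (ζ : E × E) : fderiv ℝ (fun w : E × E ↦ G w.1 a b) z ζ =
      fderiv ℝ G z.1 ζ.1 a b := by
    rw [fderiv_form_apply hG1' (differentiableAt_const a) (differentiableAt_const b), hD1]
    simp
  have key (ζ ξ η : E × E) :
      fderiv ℝ (fun w ↦ (sasakiCoord G w).comp (tangentJCoord G w)) z ζ ξ η =
        fderiv ℝ G z.1 ζ.1 ξ.1 η.2 - fderiv ℝ G z.1 ζ.1 η.1 ξ.2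
          + (fderiv ℝ (fderiv ℝ G) z.1 ζ.1 η.1 z.2 ξ.1 + fderiv ℝ G z.1 η.1 ζ.2 ξ.1)
          - (fderiv ℝ (fderiv ℝ G) z.1 ζ.1 ξ.1 z.2 η.1 + fderiv ℝ G z.1 ξ.1 ζ.2 η.1) := by
    have h : (fun w ↦ (sasakiCoord G w).comp (tangentJCoord G w) ξ η) =ᶠ[𝓝 z]
        fun w ↦ G w.1 ξ.1 η.2 - G w.1 η.1 ξ.2 + fderiv ℝ G w.1 η.1 w.2 ξ.1
          - fderiv ℝ G w.1 ξ.1 w.2 η.1 := by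
      have hc : Tendsto Prod.fst (𝓝 z) (𝓝 z.1) := continuousAt_fst
      filter_upwards [hc.eventually hn, hc.eventually hev, hc.eventually hs.eventually_nhds]
        with w h1 h2 h3 using sasakiCoord_tangentJCoord h1 h2 h3 ξ η
    have := congrArg (fun L : E × E →L[ℝ] ℝ ↦ L ζ) h.fderiv_eq
    rw [fderiv_form_apply hd (differentiableAt_const _) (differentiableAt_const _),
      ((((hd1 _ _).hasFDerivAt.fun_sub (hd1 _ _).hasFDerivAt).fun_add
        (hd2 _ _).hasFDerivAt).fun_sub (hd2 _ _).hasFDerivAt).fderiv,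
      sub_apply, add_apply, sub_apply, hT1, hT1, hT2, hT2] at this
    simpa using this
  have hs' := fderiv_form_symm hG1 hs
  rw [key, key, key, hsym η.1 ξ.1, hsym ζ.1 ξ.1, hsym ζ.1 η.1, hs' _ ξ.2, hs' _ ξ.2, hs' _ η.2,
    hs' _ η.2, hs' _ ζ.2, hs' _ ζ.2]
  ring

/-- The curvature tensor, computed in a vector space. -/
def curvatureCoord (G : E → E →L[ℝ] E →L[ℝ] ℝ) (x a b c : E) : E :=
  fderiv ℝ (leviCivita G) x a b c - fderiv ℝ (leviCivita G) x b a c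
    + leviCivita G x a (leviCivita G x b c) - leviCivita G x b (leviCivita G x a c)

/-- Since `J(0, c) = (-c, Γ(y, c))` has constant first component, all derivatives of `J` involved
are vertical. The horizontal component of `N` is `Γ(b, c) - Γ(c, b)` up to sign, hence zero; the
vertical one collects the terms of `-R(b, c) y`. -/
theorem nijenhuisCoord_tangentJCoord
    (hn : ∀ a : E, (∀ b : E, G z.1 a b = 0) → a = 0) (hG : ContDiffAt ℝ ∞ G z.1)
    (hs : ∀ᶠ y in 𝓝 z.1, ∀ a b : E, G y a b = G y b a) (b c : E) :
    nijenhuisCoord (tangentJCoord G) z (0, b) (0, c) = (0, -curvatureCoord G z.1 b c z.2) := by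
  have hJ : DifferentiableAt ℝ (tangentJCoord G) z :=
    (contDiffAt_tangentJCoord hn hG).differentiableAt (by simp)
  have hΓ : DifferentiableAt ℝ (leviCivita G) z.1 :=
    (contDiffAt_leviCivita hn hG).differentiableAt (by simp)
  have hG1 : DifferentiableAt ℝ G z.1 := hG.differentiableAt (by simp)
  have hev : ∀ᶠ y in 𝓝 z.1, DifferentiableAt ℝ G y := by
    filter_upwards [(hG.of_le (m := 1) (by simp)).eventually (by simp)] with y hy
      using hy.differentiableAt (by simp)
  have hΓs := leviCivita_symm hG1 hs
  have hΓs' (a b c : E) : fderiv ℝ (leviCivita G) z.1 a b c =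
      fderiv ℝ (leviCivita G) z.1 a c b := by
    have h : (fun y ↦ leviCivita G y b c) =ᶠ[𝓝 z.1] fun y ↦ leviCivita G y c b := by
      filter_upwards [hev, hs.eventually_nhds] with y h1 h2 using leviCivita_symm h1 h2 b c
    have := congrArg (fun L : E →L[ℝ] E ↦ L a) h.fderiv_eq
    rwa [fderiv_clm_apply_const (hΓ.clm_apply (differentiableAt_const b)),
      fderiv_clm_apply_const (hΓ.clm_apply (differentiableAt_const c)),
      fderiv_clm_apply_const hΓ, fderiv_clm_apply_const hΓ] at this
  have hfst : DifferentiableAt ℝ (Prod.fst : E × E → E) z := differentiableAt_fst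
  have hΓ' : DifferentiableAt ℝ (fun w : E × E ↦ leviCivita G w.1) z := hΓ.comp z hfst
  have hΓ2 : DifferentiableAt ℝ (fun w : E × E ↦ leviCivita G w.1 w.2) z :=
    hΓ'.clm_apply differentiableAt_snd
  have hv (w : E × E) (c : E) : tangentJCoord G w (0, c) = (-c, leviCivita G w.1 w.2 c) := by
    rw [tangentJCoord, liftJ_apply]
    simp
  have hdJ (ζ : E × E) (c : E) : fderiv ℝ (tangentJCoord G) z ζ (0, c) =
      (0, fderiv ℝ (leviCivita G) z.1 ζ.1 z.2 c + leviCivita G z.1 ζ.2 c) := by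
    rw [← fderiv_clm_apply_const hJ]
    simp only [hv]
    rw [DifferentiableAt.fderiv_prodMk (differentiableAt_const _)
      (hΓ2.clm_apply (differentiableAt_const c)), ContinuousLinearMap.prod_apply,
      fderiv_clm_apply_const hΓ2, fderiv_clm_apply hΓ' differentiableAt_snd,
      fderiv_fun_comp z hΓ hfst, fderiv_fst, fderiv_snd]
    simp [add_comm]
  rw [nijenhuisCoord, hdJ, hdJ, hdJ, hdJ, hv, hv, hv, hv, curvatureCoord]
  simp only [map_neg, neg_apply, map_zero, zero_apply, zero_add, hΓs c b]
  rw [hΓs' b c, hΓs' c b, hΓs (leviCivita G z.1 z.2 b) c, hΓs (leviCivita G z.1 z.2 c) b,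
    hΓs z.2 b, hΓs z.2 c]
  ext
  · simp
  · simp
    abel

/-- The lifted almost complex structure is parallel at `(x, y)` if and only if `R(·, ·) y = 0`. -/
theorem nablaCoord_sasakiCoord_eq_zero_iff
    (hn : ∀ᶠ x in 𝓝 z.1, ∀ a : E, (∀ b : E, G x a b = 0) → a = 0) (hG : ContDiffAt ℝ ∞ G z.1)
    (hs : ∀ᶠ y in 𝓝 z.1, ∀ a b : E, G y a b = G y b a) :
    (∀ ξ η, nablaCoord (sasakiCoord G) (tangentJCoord G) z ξ η = 0) ↔
      ∀ b c, curvatureCoord G z.1 b c z.2 = 0 := by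
  have hJ : DifferentiableAt ℝ (tangentJCoord G) z :=
    (contDiffAt_tangentJCoord hn.self_of_nhds hG).differentiableAt (by simp)
  have hc : Tendsto Prod.fst (𝓝 z) (𝓝 z.1) := continuousAt_fst
  have hJ2 : ∀ᶠ w in 𝓝 z, ∀ ξ, tangentJCoord G w (tangentJCoord G w ξ) = -ξ :=
    Eventually.of_forall fun w ξ ↦ liftJ_liftJ _ ξ
  rw [nablaCoord_eq_zero_iff
    ((contDiffAt_sasakiCoord hn.self_of_nhds hG).differentiableAt (by simp)) hJ
    (liftForm_nondegenerate hn.self_of_nhds _)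
    ((hc.eventually hs).mono fun w hw ↦ liftForm_symm hw _) hJ2
    (Eventually.of_forall fun w ↦ liftForm_liftJ _ _)
    (isClosed_sasakiCoord_tangentJCoord hn hG hs)]
  constructor
  · intro h b c
    have := congrArg Prod.snd (h (0, b) (0, c))
    rw [nijenhuisCoord_tangentJCoord hn.self_of_nhds hG hs] at this
    simpa using this
  · intro h
    refine nijenhuisCoord_eq_zero hJ hJ2 (Set.range (Prod.mk (0 : E))) ?_ ?_
    · intro v
      -- `J(0, t)` has first component `-t`, which forces `t = -v.1`; what remains is the vertical
      -- part of `v`.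
      refine ⟨_, ⟨v.2 + leviCivita G z.1 z.2 v.1, rfl⟩, _, ⟨-v.1, rfl⟩, ?_⟩
      rw [tangentJCoord, liftJ_apply]
      ext <;> simp
    · rintro _ ⟨b, rfl⟩ _ ⟨c, rfl⟩
      rw [nijenhuisCoord_tangentJCoord hn.self_of_nhds hG hs, h, neg_zero, Prod.mk_zero_zero]

end Lift

/-! ### Components of tensor fields in charts -/

section Charts

variable {V : Type*} [NormedAddCommGroup V] [NormedSpace ℝ V]
  {H : Type*} [TopologicalSpace H] {I : ModelWithCorners ℝ V H}
  {N : Type*} [TopologicalSpace N] [ChartedSpace H N]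

theorem symm_mem_chartAt_source {p : N} {y : V} (hy : y ∈ (extChartAt I p).target) :
    (extChartAt I p).symm y ∈ (chartAt H p).source := by
  rw [← extChartAt_source I]
  exact (extChartAt I p).map_target hy

theorem contDiffAt_congr_iff {F : Type*} [NormedAddCommGroup F] [NormedSpace ℝ F] {f f' : V → F}
    {x : V} (h : f =ᶠ[𝓝 x] f') : ContDiffAt ℝ ∞ f x ↔ ContDiffAt ℝ ∞ f' x :=
  ⟨fun hf ↦ hf.congr_of_eventuallyEq h.symm, fun hf ↦ hf.congr_of_eventuallyEq h⟩

/-- Tangent spaces at equal points are different types until the equality is substituted; reading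
everything in `V` allows the base point to be rewritten. -/
theorem bilinField_congr (B : BilinField I N) {p q : N} (h : p = q) {v v' w w' : V}
    (hv : v = v') (hw : w = w') :
    (B p : V →L[ℝ] V →L[ℝ] ℝ) v w = (B q : V →L[ℝ] V →L[ℝ] ℝ) v' w' := by
  subst h hv hw; rfl

theorem coordForm_symm {B : BilinField I N} (hB : ∀ p v w, B p v w = B p w v) (p : N) (y a b : V) :
    coordForm B p y a b = coordForm B p y b a := hB _ _ _

section

variable [IsManifold I 1 N]

theorem continuousLinearMapAt_eq_chartCoframe {p : N} {y : V}
    (hy : y ∈ (extChartAt I p).target) :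
    (trivializationAt V (TangentSpace I) p).continuousLinearMapAt ℝ ((extChartAt I p).symm y) =
      chartCoframe p y :=
  TangentBundle.continuousLinearMapAt_trivializationAt (I := I) (symm_mem_chartAt_source hy)

end

variable [I.Boundaryless]

theorem contMDiffAt_iff_contDiffAt_comp_symm {F : Type*} [NormedAddCommGroup F] [NormedSpace ℝ F]
    {f : N → F} {p : N} : ContMDiffAt I 𝓘(ℝ, F) ∞ f p ↔
      ContDiffAt ℝ ∞ (f ∘ (extChartAt I p).symm) (extChartAt I p p) := by
  rw [contMDiffAt_iff_source, I.range_eq_univ, contMDiffWithinAt_univ, contMDiffAt_iff_contDiffAt]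

section C1

variable [IsManifold I 1 N]

theorem mdifferentiableAt_extChartAt_symm {p : N} {y : V} (hy : y ∈ (extChartAt I p).target) :
    MDifferentiableAt 𝓘(ℝ, V) I (extChartAt I p).symm y := by
  have := mdifferentiableWithinAt_extChartAt_symm hy
  rwa [I.range_eq_univ, mdifferentiableWithinAt_univ] at this

theorem chartCoframe_comp_chartFrame {p : N} {y : V} (hy : y ∈ (extChartAt I p).target) :
    (chartCoframe (I := I) p y).comp (chartFrame p y) = ContinuousLinearMap.id ℝ V := by
  have := mfderiv_extChartAt_comp_mfderivWithin_extChartAt_symm hy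
  rwa [I.range_eq_univ, mfderivWithin_univ] at this

theorem chartFrame_comp_chartCoframe {p : N} {y : V} (hy : y ∈ (extChartAt I p).target) :
    (chartFrame p y).comp (chartCoframe (I := I) p y) = ContinuousLinearMap.id ℝ _ := by
  have := mfderivWithin_extChartAt_symm_comp_mfderiv_extChartAt hy
  rwa [I.range_eq_univ, mfderivWithin_univ] at this

theorem chartFrame_surjective {p : N} {y : V} (hy : y ∈ (extChartAt I p).target) :
    Function.Surjective (chartFrame (I := I) p y) := fun v ↦
  ⟨chartCoframe p y v, congrArg (fun L ↦ L v) (chartFrame_comp_chartCoframe hy)⟩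

/-- The tangent space at a point is identified with `V` by the preferred chart there, so the frame
of another chart is the derivative of a transition map. -/
theorem chartFrame_eq_fderiv {p : N} {y : V} (hy : y ∈ (extChartAt I p).target) :
    (chartFrame (I := I) p y : V →L[ℝ] V) =
      fderiv ℝ (extChartAt I ((extChartAt I p).symm y) ∘ (extChartAt I p).symm) y := by
  refine (mdifferentiableAt_extChartAt_symm hy).mfderiv.trans ?_
  simp only [writtenInExtChartAt, extChartAt_model_space_eq_id, PartialEquiv.refl_symm,
    PartialEquiv.refl_coe, Function.comp_id, modelWithCornersSelf_coe, Set.range_id,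
    fderivWithin_univ, id_eq]
  rfl

theorem symmL_eq_chartFrame {p : N} {y : V} (hy : y ∈ (extChartAt I p).target) :
    (trivializationAt V (TangentSpace I) p).symmL ℝ ((extChartAt I p).symm y) =
      chartFrame p y := by
  have h := TangentBundle.symmL_trivializationAt (I := I) (symm_mem_chartAt_source hy)
  have h2 : (mfderivWithin 𝓘(ℝ, V) I (extChartAt I p).symm (Set.range I)
      (extChartAt I p ((extChartAt I p).symm y)) : V →L[ℝ] V) =
      (chartFrame (I := I) p y : V →L[ℝ] V) := by
    rw [I.range_eq_univ, mfderivWithin_univ, (extChartAt I p).right_inv hy]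
    rfl
  exact h.trans h2

theorem trivialization_bilin_eq_coordForm (B : BilinField I N) {p : N} {y : V}
    (hy : y ∈ (extChartAt I p).target) :
    (trivializationAt (V →L[ℝ] V →L[ℝ] ℝ)
      (fun p : N ↦ TangentSpace I p →L[ℝ] TangentSpace I p →L[ℝ] ℝ) p
      ⟨(extChartAt I p).symm y, B ((extChartAt I p).symm y)⟩).2 = coordForm B p y := by
  have hs := symm_mem_chartAt_source hy
  ext v w
  rw [hom_trivializationAt_apply]
  dsimp only
  rw [inCoordinates_apply_eq₂ (by simpa using hs) (by simpa using hs) (by simp),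
    ← Trivialization.symmL_apply (R := ℝ) _ (by simpa using hs),
    ← Trivialization.symmL_apply (R := ℝ) _ (by simpa using hs), symmL_eq_chartFrame hy]
  simp only [Trivial.fiberBundle_trivializationAt', Trivial.linearMapAt_trivialization, LinearMap.id_coe, id_eq]
  rfl

theorem trivialization_endo_eq_coordEndo (A : EndoField I N) {p : N} {y : V}
    (hy : y ∈ (extChartAt I p).target) :
    (trivializationAt (V →L[ℝ] V) (fun p : N ↦ TangentSpace I p →L[ℝ] TangentSpace I p) p
      ⟨(extChartAt I p).symm y, A ((extChartAt I p).symm y)⟩).2 = coordEndo A p y := by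
  rw [hom_trivializationAt_apply]
  dsimp only
  rw [ContinuousLinearMap.inCoordinates, symmL_eq_chartFrame hy,
    continuousLinearMapAt_eq_chartCoframe hy]
  rfl

/-- Near `p`, the trivialization of the bundle of forms reads a section as its chart components. -/
theorem contMDiffAt_bilin_iff (B : BilinField I N) (p : N) :
    ContMDiffAt I (I.prod 𝓘(ℝ, V →L[ℝ] V →L[ℝ] ℝ)) ∞
      (fun p : N ↦ (TotalSpace.mk' (V →L[ℝ] V →L[ℝ] ℝ) p (B p) :
        TotalSpace (V →L[ℝ] V →L[ℝ] ℝ)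
          (fun p : N ↦ TangentSpace I p →L[ℝ] TangentSpace I p →L[ℝ] ℝ))) p ↔
      ContDiffAt ℝ ∞ (coordForm B p) (extChartAt I p p) := by
  rw [contMDiffAt_section, contMDiffAt_iff_contDiffAt_comp_symm]
  refine contDiffAt_congr_iff ?_
  filter_upwards [extChartAt_target_mem_nhds (I := I) p] with y hy using trivialization_bilin_eq_coordForm B hy

theorem contMDiffAt_endo_iff (A : EndoField I N) (p : N) :
    ContMDiffAt I (I.prod 𝓘(ℝ, V →L[ℝ] V)) ∞
      (fun p : N ↦ (TotalSpace.mk' (V →L[ℝ] V) p (A p) :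
        TotalSpace (V →L[ℝ] V) (fun p : N ↦ TangentSpace I p →L[ℝ] TangentSpace I p))) p ↔
      ContDiffAt ℝ ∞ (coordEndo A p) (extChartAt I p p) := by
  rw [contMDiffAt_section, contMDiffAt_iff_contDiffAt_comp_symm]
  refine contDiffAt_congr_iff ?_
  filter_upwards [extChartAt_target_mem_nhds (I := I) p] with y hy using trivialization_endo_eq_coordEndo A hy

theorem coordForm_nondegenerate {B : BilinField I N} (hB : ∀ p v, (∀ w, B p v w = 0) → v = 0)
    {p : N} {y : V} (hy : y ∈ (extChartAt I p).target) (a : V)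
    (h : ∀ b, coordForm B p y a b = 0) : a = 0 := by
  have h1 : chartFrame (I := I) p y a = 0 := hB _ _ fun w ↦ by
    obtain ⟨b, rfl⟩ := chartFrame_surjective hy w
    exact h b
  have h2 := congrArg (fun L : V →L[ℝ] V ↦ L a) (chartCoframe_comp_chartFrame (I := I) hy)
  have h3 : chartCoframe p y (chartFrame (I := I) p y a) = a := h2
  rw [← h3, h1, map_zero]

/-- The components of a bilinear form in two charts. -/
theorem coordForm_transition (B : BilinField I N) (p q : N) {y : V}
    (hy : y ∈ (extChartAt I p).target) (hq : (extChartAt I p).symm y ∈ (extChartAt I q).source)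
    (a b : V) : coordForm B p y a b =
      coordForm B q ((extChartAt I q ∘ (extChartAt I p).symm) y)
        (fderiv ℝ (extChartAt I q ∘ (extChartAt I p).symm) y a)
        (fderiv ℝ (extChartAt I q ∘ (extChartAt I p).symm) y b) := by
  set ψ := extChartAt I q ∘ (extChartAt I p).symm
  have hq' : ψ y ∈ (extChartAt I q).target := (extChartAt I q).map_source hq
  have hφ := mdifferentiableAt_extChartAt_symm (I := I) hy
  have hψd : MDifferentiableAt 𝓘(ℝ, V) 𝓘(ℝ, V) ψ y :=
    (mdifferentiableAt_extChartAt (by rwa [extChartAt_source] at hq)).comp y hφ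
  -- The chain rule applied to this factorization relates the two coordinate frames.
  have hev : (extChartAt I p).symm =ᶠ[𝓝 y] (extChartAt I q).symm ∘ ψ := by
    have : (extChartAt I p).symm ⁻¹' (extChartAt I q).source ∈ 𝓝 y :=
      hφ.continuousAt.preimage_mem_nhds ((isOpen_extChartAt_source q).mem_nhds hq)
    filter_upwards [this] with z hz using ((extChartAt I q).left_inv hz).symm
  have hfr (v : V) : (chartFrame (I := I) p y v : V) =
      (chartFrame (I := I) q (ψ y) (fderiv ℝ ψ y v) : V) := by
    have h1 : (mfderiv 𝓘(ℝ, V) I (extChartAt I p).symm y : V →L[ℝ] V) =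
        (mfderiv 𝓘(ℝ, V) I ((extChartAt I q).symm ∘ ψ) y : V →L[ℝ] V) := hev.mfderiv_eq
    rw [mfderiv_comp y (mdifferentiableAt_extChartAt_symm hq') hψd, mfderiv_eq_fderiv] at h1
    exact congrArg (fun L : V →L[ℝ] V ↦ L v) h1
  have hpt : (extChartAt I p).symm y = (extChartAt I q).symm (ψ y) :=
    ((extChartAt I q).left_inv hq).symm
  exact bilinField_congr B hpt (hfr a) (hfr b)

end C1

theorem contDiffAt_transition [IsManifold I ∞ N] (p q : N) {y : V}
    (hy : y ∈ (extChartAt I p).target) (hq : (extChartAt I p).symm y ∈ (extChartAt I q).source) :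
    ContDiffAt ℝ ∞ (extChartAt I q ∘ (extChartAt I p).symm) y := by
  have := contDiffWithinAt_ext_coord_change (I := I) (n := ∞) q p (y := y) ⟨hy, hq⟩
  rwa [I.range_eq_univ, contDiffWithinAt_univ] at this

end Charts

/-! ### Induced coordinates of the tangent bundle -/

section InducedCoordinates

variable {E : Type*} [NormedAddCommGroup E] [NormedSpace ℝ E]
  {M : Type*} [TopologicalSpace M] [ChartedSpace E M] [IsManifold 𝓘(ℝ, E) ∞ M]

theorem mem_extChartAt_tangent_target (u : TangentBundle 𝓘(ℝ, E) M) {z : E × E}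
    (hz : z.1 ∈ (extChartAt 𝓘(ℝ, E) u.proj).target) :
    z ∈ (extChartAt 𝓘(ℝ, E).tangent u).target := by
  rw [FiberBundle.extChartAt_target]
  exact ⟨⟨hz, symm_mem_chartAt_source hz⟩, trivial⟩

theorem extChartAt_tangent_symm (u : TangentBundle 𝓘(ℝ, E) M) {z : E × E}
    (hz : z.1 ∈ (extChartAt 𝓘(ℝ, E) u.proj).target) :
    (extChartAt 𝓘(ℝ, E).tangent u).symm z =
      ⟨(extChartAt 𝓘(ℝ, E) u.proj).symm z.1, chartFrame u.proj z.1 z.2⟩ := by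
  have hs := symm_mem_chartAt_source hz
  have h : (extChartAt 𝓘(ℝ, E).tangent u).symm z =
      (trivializationAt E (TangentSpace 𝓘(ℝ, E)) u.proj).toOpenPartialHomeomorph.symm
        ((extChartAt 𝓘(ℝ, E) u.proj).symm z.1, z.2) := by
    rw [FiberBundle.extChartAt]
    rfl
  rw [h, ← Trivialization.mk_symm _ (by simpa using hs),
    ← Trivialization.symmL_apply (R := ℝ) _ (by simpa using hs), symmL_eq_chartFrame hz]

theorem extChartAt_tangent_mk (u : TangentBundle 𝓘(ℝ, E) M) {r : M}
    (hr : r ∈ (extChartAt 𝓘(ℝ, E) u.proj).source) (v : TangentSpace 𝓘(ℝ, E) r) :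
    extChartAt 𝓘(ℝ, E).tangent u ⟨r, v⟩ =
      (extChartAt 𝓘(ℝ, E) u.proj r,
        mfderiv 𝓘(ℝ, E) 𝓘(ℝ, E) (extChartAt 𝓘(ℝ, E) u.proj) r v) := by
  rw [extChartAt_source] at hr
  have h1 : (extChartAt 𝓘(ℝ, E).tangent u ⟨r, v⟩ : E × E) = (extChartAt 𝓘(ℝ, E) u.proj r,
      (trivializationAt E (TangentSpace 𝓘(ℝ, E)) u.proj).continuousLinearMapAt ℝ r v) := by
    rw [FiberBundle.extChartAt, Trivialization.continuousLinearMapAt_apply,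
      Trivialization.coe_linearMapAt_of_mem _ (by simpa using hr)]
    rfl
  refine h1.trans (Prod.ext rfl ?_)
  exact congrArg (fun L : E →L[ℝ] E ↦ L v)
    (TangentBundle.continuousLinearMapAt_trivializationAt (I := 𝓘(ℝ, E)) hr)

/-- The induced coordinate change `(x, y) ↦ (ψ x, Dψ_x y)`. -/
theorem extChartAt_tangent_transition (u : TangentBundle 𝓘(ℝ, E) M) (w : TangentBundle 𝓘(ℝ, E) M)
    {z : E × E} (hz : z.1 ∈ (extChartAt 𝓘(ℝ, E) u.proj).target)
    (hw : (extChartAt 𝓘(ℝ, E) u.proj).symm z.1 ∈ (extChartAt 𝓘(ℝ, E) w.proj).source) :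
    extChartAt 𝓘(ℝ, E).tangent w ((extChartAt 𝓘(ℝ, E).tangent u).symm z) =
      ((extChartAt 𝓘(ℝ, E) w.proj ∘ (extChartAt 𝓘(ℝ, E) u.proj).symm) z.1,
        fderiv ℝ (extChartAt 𝓘(ℝ, E) w.proj ∘ (extChartAt 𝓘(ℝ, E) u.proj).symm) z.1 z.2) := by
  rw [extChartAt_tangent_symm u hz, extChartAt_tangent_mk w hw]
  have h := mfderiv_comp z.1 (mdifferentiableAt_extChartAt (I := 𝓘(ℝ, E)) (x := w.proj)
    (by rwa [extChartAt_source] at hw)) (mdifferentiableAt_extChartAt_symm hz)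
  rw [mfderiv_eq_fderiv] at h
  rw [h]
  rfl

/-- The change of coordinates from the preferred chart at `p` to the preferred chart at the point
with coordinates `x`. -/
def centeredTransition (p : M) (x : E) : E → E :=
  extChartAt 𝓘(ℝ, E) ((extChartAt 𝓘(ℝ, E) p).symm x) ∘ (extChartAt 𝓘(ℝ, E) p).symm

theorem contDiffAt_centeredTransition (p : M) {x : E} (hx : x ∈ (extChartAt 𝓘(ℝ, E) p).target) :
    ContDiffAt ℝ ∞ (centeredTransition p x) x :=
  contDiffAt_transition p _ hx (mem_extChartAt_source _)

theorem chartFrame_apply (p : M) {x : E} (hx : x ∈ (extChartAt 𝓘(ℝ, E) p).target) (a : E) :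
    chartFrame (I := 𝓘(ℝ, E)) p x a = fderiv ℝ (centeredTransition p x) x a :=
  congrArg (fun L : E →L[ℝ] E ↦ L a) (chartFrame_eq_fderiv (I := 𝓘(ℝ, E)) hx)

/-- This is the derivative of the induced coordinate change `(x, y) ↦ (ψ x, Dψ_x y)`. -/
theorem chartFrame_tangent (u : TangentBundle 𝓘(ℝ, E) M) {z : E × E}
    (hz : z.1 ∈ (extChartAt 𝓘(ℝ, E) u.proj).target) (ξ : E × E) :
    chartFrame (I := 𝓘(ℝ, E).tangent) u z ξ =
      ((fderiv ℝ (centeredTransition u.proj z.1) z.1 ξ.1,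
        fderiv ℝ (fderiv ℝ (centeredTransition u.proj z.1)) z.1 ξ.1 z.2
          + fderiv ℝ (centeredTransition u.proj z.1) z.1 ξ.2) : E × E) := by
  have hp : ((extChartAt 𝓘(ℝ, E).tangent u).symm z).proj =
      (extChartAt 𝓘(ℝ, E) u.proj).symm z.1 := by rw [extChartAt_tangent_symm u hz]
  have h1 := congrArg (fun L : E × E →L[ℝ] E × E ↦ L ξ)
    (chartFrame_eq_fderiv (I := 𝓘(ℝ, E).tangent) (mem_extChartAt_tangent_target u hz))
  set ψ := centeredTransition u.proj z.1
  set q := (extChartAt 𝓘(ℝ, E) u.proj).symm z.1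
  have hqs : q ∈ (extChartAt 𝓘(ℝ, E) q).source := mem_extChartAt_source q
  have hψ : ContDiffAt ℝ ∞ ψ z.1 := contDiffAt_centeredTransition u.proj hz
  have hev : (extChartAt 𝓘(ℝ, E).tangent ((extChartAt 𝓘(ℝ, E).tangent u).symm z) ∘
      (extChartAt 𝓘(ℝ, E).tangent u).symm) =ᶠ[𝓝 z] fun w ↦ (ψ w.1, fderiv ℝ ψ w.1 w.2) := by
    have hc : Tendsto Prod.fst (𝓝 z) (𝓝 z.1) := continuousAt_fst
    have hsrc : (extChartAt 𝓘(ℝ, E) u.proj).symm ⁻¹' (extChartAt 𝓘(ℝ, E) q).source ∈ 𝓝 z.1 :=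
      (mdifferentiableAt_extChartAt_symm hz).continuousAt.preimage_mem_nhds
        ((isOpen_extChartAt_source q).mem_nhds hqs)
    filter_upwards [hc ((isOpen_extChartAt_target u.proj).mem_nhds hz), hc hsrc] with w h3 h4
    rw [Function.comp_apply, extChartAt_tangent_transition u _ h3 (by rw [hp]; exact h4), hp]
    rfl
  have hfst : DifferentiableAt ℝ (Prod.fst : E × E → E) z := differentiableAt_fst
  have hψ1 : DifferentiableAt ℝ ψ z.1 := hψ.differentiableAt (by simp)
  have hψ2 : DifferentiableAt ℝ (fderiv ℝ ψ) z.1 :=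
    (hψ.fderiv_right (m := ∞) le_rfl).differentiableAt (by simp)
  have hψ1' : DifferentiableAt ℝ (fun w : E × E ↦ ψ w.1) z := hψ1.comp z hfst
  have hψ2' : DifferentiableAt ℝ (fun w : E × E ↦ fderiv ℝ ψ w.1) z := hψ2.comp z hfst
  refine h1.trans ?_
  rw [hev.fderiv_eq, DifferentiableAt.fderiv_prodMk hψ1' (hψ2'.clm_apply differentiableAt_snd),
    ContinuousLinearMap.prod_apply, fderiv_clm_apply hψ2' differentiableAt_snd,
    fderiv_fun_comp z hψ1 hfst, fderiv_fun_comp z hψ2 hfst, fderiv_fst, fderiv_snd]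
  simp [add_comm]

variable {g : BilinField 𝓘(ℝ, E) M}

theorem contDiffAt_coordForm (hg : IsPseudoRiemannianMetric g) (p : M) :
    ContDiffAt ℝ ∞ (coordForm g p) (extChartAt 𝓘(ℝ, E) p p) :=
  (contMDiffAt_bilin_iff g p).1 (hg.smooth p)

theorem eventually_differentiableAt_coordForm (hg : IsPseudoRiemannianMetric g) (p : M) :
    ∀ᶠ x in 𝓝 (extChartAt 𝓘(ℝ, E) p p), DifferentiableAt ℝ (coordForm g p) x := by
  filter_upwards [((contDiffAt_coordForm hg p).of_le (m := 1) (by simp)).eventually (by simp)]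
    with y hy using hy.differentiableAt (by simp)

/-- The transformation law of the Christoffel symbols, from the preferred chart at `p` to the
preferred chart at the point with coordinates `x`. -/
theorem fderiv_leviCivita [FiniteDimensional ℝ E] (hg : IsPseudoRiemannianMetric g) (p : M) {x : E}
    (hx : x ∈ (extChartAt 𝓘(ℝ, E) p).target) (hd : DifferentiableAt ℝ (coordForm g p) x)
    (a b : E) : fderiv ℝ (centeredTransition p x) x (leviCivita (coordForm g p) x a b) =
      fderiv ℝ (fderiv ℝ (centeredTransition p x)) x a b
        + leviCivita (coordForm g ((extChartAt 𝓘(ℝ, E) p).symm x)) (centeredTransition p x x)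
          (fderiv ℝ (centeredTransition p x) x a) (fderiv ℝ (centeredTransition p x) x b) := by
  have hev : ∀ᶠ y in 𝓝 x, ∀ a b : E, coordForm g p y a b =
      coordForm g ((extChartAt 𝓘(ℝ, E) p).symm x) (centeredTransition p x y)
        (fderiv ℝ (centeredTransition p x) y a) (fderiv ℝ (centeredTransition p x) y b) := by
    have hsrc := (mdifferentiableAt_extChartAt_symm hx).continuousAt.preimage_mem_nhds
      (extChartAt_source_mem_nhds (I := 𝓘(ℝ, E)) ((extChartAt 𝓘(ℝ, E) p).symm x))
    filter_upwards [(isOpen_extChartAt_target p).mem_nhds hx, hsrc] with y h3 h4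
      using coordForm_transition g p _ h3 h4
  exact leviCivita_transform (contDiffAt_centeredTransition p hx)
    ((contDiffAt_coordForm hg _).differentiableAt (by simp))
    (Eventually.of_forall fun y ↦ coordForm_symm hg.symm _ y)
    (coordForm_nondegenerate hg.nondegenerate (mem_extChartAt_target _))
    (coordForm_nondegenerate hg.nondegenerate hx) hev hd
    (fun v ↦ (chartFrame_surjective (I := 𝓘(ℝ, E)) hx v).imp fun a ha ↦
      (chartFrame_apply p hx a).symm.trans ha) a b

end InducedCoordinates

/-! ### The lifted structures of the tangent bundle in induced coordinates -/

section TangentLift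

variable {E : Type*} [NormedAddCommGroup E] [NormedSpace ℝ E]
  {M : Type*} [TopologicalSpace M] [ChartedSpace E M] [IsManifold 𝓘(ℝ, E) ∞ M]
  {g : BilinField 𝓘(ℝ, E) M}

variable [FiniteDimensional ℝ E]

/-- In induced coordinates the vertical part of a tangent vector `(a, b)` at `(x, y)` is
`b + Γ(y, a)`. -/
theorem verticalPart_chartFrame (hg : IsPseudoRiemannianMetric g) (p : M) {z : E × E}
    (hz : z.1 ∈ (extChartAt 𝓘(ℝ, E) p).target) (hd : DifferentiableAt ℝ (coordForm g p) z.1)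
    (ξ : E × E) :
    fderiv ℝ (fderiv ℝ (centeredTransition p z.1)) z.1 ξ.1 z.2
        + fderiv ℝ (centeredTransition p z.1) z.1 ξ.2
        + christoffelAt g ((extChartAt 𝓘(ℝ, E) p).symm z.1)
          (fderiv ℝ (centeredTransition p z.1) z.1 z.2)
          (fderiv ℝ (centeredTransition p z.1) z.1 ξ.1) =
      fderiv ℝ (centeredTransition p z.1) z.1 (ξ.2 + leviCivita (coordForm g p) z.1 z.2 ξ.1) := by
  -- `D²ψ(ξ.1, y) = D²ψ(y, ξ.1)` is the inhomogeneous term in the transformation law of `Γ(y, ξ.1)`.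
  have hsymm := ((contDiffAt_centeredTransition p hz).isSymmSndFDerivAt
    (by simpa using WithTop.coe_le_coe.2 (le_top : (2 : ℕ∞) ≤ ⊤))).eq ξ.1 z.2
  rw [map_add, fderiv_leviCivita hg p hz hd, hsymm, add_right_comm, add_comm, ← add_assoc]
  exact add_assoc _ _ _

/-- The Sasaki metric is defined in the chart centred at each point. Both parts of a vector pass to
that chart by `Dψ`, along which `g` pulls back to its components in the fixed chart. -/
theorem coordForm_sasakiMetric (hg : IsPseudoRiemannianMetric g) (u : TangentBundle 𝓘(ℝ, E) M)
    {z : E × E} (hz : z.1 ∈ (extChartAt 𝓘(ℝ, E) u.proj).target)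
    (hd : DifferentiableAt ℝ (coordForm g u.proj) z.1) :
    coordForm (sasakiMetric g) u z = sasakiCoord (coordForm g u.proj) z := by
  refine ContinuousLinearMap.ext fun ξ ↦ ContinuousLinearMap.ext fun η ↦ ?_
  set ψ := centeredTransition u.proj z.1
  set q := (extChartAt 𝓘(ℝ, E) u.proj).symm z.1
  have hpt : (extChartAt 𝓘(ℝ, E).tangent u).symm z = ⟨q, fderiv ℝ ψ z.1 z.2⟩ :=
    (extChartAt_tangent_symm u hz).trans
      (congrArg (fun v ↦ (⟨q, v⟩ : TangentBundle 𝓘(ℝ, E) M)) (chartFrame_apply u.proj hz z.2))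
  obtain ⟨B, hB⟩ : ∃ B : E →L[ℝ] E →L[ℝ] ℝ, g q = B := ⟨_, rfl⟩
  have h1 : coordForm (sasakiMetric g) u z ξ η = liftForm B
      (christoffelAt g q (fderiv ℝ ψ z.1 z.2))
      (fderiv ℝ ψ z.1 ξ.1, fderiv ℝ (fderiv ℝ ψ) z.1 ξ.1 z.2 + fderiv ℝ ψ z.1 ξ.2)
      (fderiv ℝ ψ z.1 η.1, fderiv ℝ (fderiv ℝ ψ) z.1 η.1 z.2 + fderiv ℝ ψ z.1 η.2) := by
    subst hB
    exact bilinField_congr (sasakiMetric g) hpt (chartFrame_tangent u hz ξ)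
      (chartFrame_tangent u hz η)
  have hB' (a b : E) : B (fderiv ℝ ψ z.1 a) (fderiv ℝ ψ z.1 b) =
      coordForm g u.proj z.1 a b := by
    subst hB
    exact bilinField_congr g rfl (chartFrame_apply u.proj hz a).symm
      (chartFrame_apply u.proj hz b).symm
  rw [h1, liftForm_apply, verticalPart_chartFrame hg u.proj hz hd,
    verticalPart_chartFrame hg u.proj hz hd, hB', hB', sasakiCoord, liftForm_apply]

theorem endoField_congr {V H N : Type*} [NormedAddCommGroup V] [NormedSpace ℝ V]
    [TopologicalSpace H] {I : ModelWithCorners ℝ V H} [TopologicalSpace N] [ChartedSpace H N]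
    (A : EndoField I N) {p q : N} (h : p = q) {v v' : V} (hv : v = v') :
    (A p : V →L[ℝ] V) v = (A q : V →L[ℝ] V) v' := by
  subst h hv; rfl

theorem coordEndo_tangentJ₁ (hg : IsPseudoRiemannianMetric g) (u : TangentBundle 𝓘(ℝ, E) M)
    {z : E × E} (hz : z.1 ∈ (extChartAt 𝓘(ℝ, E) u.proj).target)
    (hd : DifferentiableAt ℝ (coordForm g u.proj) z.1) :
    coordEndo (tangentJ₁ g) u z = tangentJCoord (coordForm g u.proj) z := by
  refine ContinuousLinearMap.ext fun ξ ↦ ?_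
  set ψ := centeredTransition u.proj z.1
  set q := (extChartAt 𝓘(ℝ, E) u.proj).symm z.1
  have hpt : (extChartAt 𝓘(ℝ, E).tangent u).symm z = ⟨q, fderiv ℝ ψ z.1 z.2⟩ :=
    (extChartAt_tangent_symm u hz).trans
      (congrArg (fun v ↦ (⟨q, v⟩ : TangentBundle 𝓘(ℝ, E) M)) (chartFrame_apply u.proj hz z.2))
  have h1 : tangentJ₁ g ((extChartAt 𝓘(ℝ, E).tangent u).symm z)
      (chartFrame (I := 𝓘(ℝ, E).tangent) u z ξ) = liftJ
      (christoffelAt g q (fderiv ℝ ψ z.1 z.2))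
      (fderiv ℝ ψ z.1 ξ.1, fderiv ℝ (fderiv ℝ ψ) z.1 ξ.1 z.2 + fderiv ℝ ψ z.1 ξ.2) :=
    endoField_congr (tangentJ₁ g) hpt (chartFrame_tangent u hz ξ)
  -- The frame intertwines the coordinate expression with `J₁`; the coframe, its left inverse, then
  -- gives the components.
  have h2 : tangentJ₁ g ((extChartAt 𝓘(ℝ, E).tangent u).symm z)
      (chartFrame (I := 𝓘(ℝ, E).tangent) u z ξ) =
      chartFrame (I := 𝓘(ℝ, E).tangent) u z (tangentJCoord (coordForm g u.proj) z ξ) := by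
    refine h1.trans (Eq.trans ?_ (chartFrame_tangent u hz _).symm)
    have hv := verticalPart_chartFrame hg u.proj hz hd (tangentJCoord (coordForm g u.proj) z ξ)
    rw [liftJ_apply, verticalPart_chartFrame hg u.proj hz hd]
    rw [tangentJCoord, liftJ_apply] at hv ⊢
    simp only [map_neg, neg_apply, add_neg_cancel_right] at hv ⊢
    refine Prod.ext rfl ?_
    exact (add_neg_eq_iff_eq_add.1 hv).symm
  have h3 := congrArg (fun L : E × E →L[ℝ] E × E ↦ L (tangentJCoord (coordForm g u.proj) z ξ))
    (chartCoframe_comp_chartFrame (I := 𝓘(ℝ, E).tangent) (mem_extChartAt_tangent_target u hz))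
  exact (congrArg (chartCoframe (I := 𝓘(ℝ, E).tangent) u z) h2).trans h3

end TangentLift

/-! ### The almost Kähler structure of the tangent bundle -/

section Main

variable {E : Type*} [NormedAddCommGroup E] [NormedSpace ℝ E]
  {M : Type*} [TopologicalSpace M] [ChartedSpace E M] [IsManifold 𝓘(ℝ, E) ∞ M]
  {g : BilinField 𝓘(ℝ, E) M}

theorem extChartAt_tangent_self (u : TangentBundle 𝓘(ℝ, E) M) :
    extChartAt 𝓘(ℝ, E).tangent u u = (extChartAt 𝓘(ℝ, E) u.proj u.proj, u.snd) := by
  refine (extChartAt_tangent_mk u (mem_extChartAt_source u.proj) u.snd).trans (Prod.ext rfl ?_)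
  exact congrArg (fun L : E →L[ℝ] E ↦ L u.snd) (mfderiv_extChartAt_self (I := 𝓘(ℝ, E)))

theorem eventually_coordForm_nondegenerate (hg : IsPseudoRiemannianMetric g) (p : M) :
    ∀ᶠ x in 𝓝 (extChartAt 𝓘(ℝ, E) p p), ∀ a : E, (∀ b : E, coordForm g p x a b = 0) → a = 0 := by
  filter_upwards [extChartAt_target_mem_nhds (I := 𝓘(ℝ, E)) p] with x hx
    using coordForm_nondegenerate hg.nondegenerate hx

theorem eventually_extChartAt_tangent (hg : IsPseudoRiemannianMetric g)
    (u : TangentBundle 𝓘(ℝ, E) M) :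
    ∀ᶠ z : E × E in 𝓝 (extChartAt 𝓘(ℝ, E).tangent u u),
      z.1 ∈ (extChartAt 𝓘(ℝ, E) u.proj).target ∧
        DifferentiableAt ℝ (coordForm g u.proj) z.1 := by
  rw [extChartAt_tangent_self]
  have hc : Tendsto Prod.fst (𝓝 (extChartAt 𝓘(ℝ, E) u.proj u.proj, (u.snd : E)))
    (𝓝 (extChartAt 𝓘(ℝ, E) u.proj u.proj)) := continuousAt_fst
  exact (hc.eventually (extChartAt_target_mem_nhds (I := 𝓘(ℝ, E)) u.proj)).and
    (hc.eventually (eventually_differentiableAt_coordForm hg u.proj))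

variable [FiniteDimensional ℝ E]

theorem coordForm_sasakiMetric_eventuallyEq (hg : IsPseudoRiemannianMetric g)
    (u : TangentBundle 𝓘(ℝ, E) M) : coordForm (sasakiMetric g) u
      =ᶠ[𝓝 (extChartAt 𝓘(ℝ, E).tangent u u)] sasakiCoord (coordForm g u.proj) :=
  (eventually_extChartAt_tangent hg u).mono fun _ hz ↦ coordForm_sasakiMetric hg u hz.1 hz.2

theorem coordEndo_tangentJ₁_eventuallyEq (hg : IsPseudoRiemannianMetric g)
    (u : TangentBundle 𝓘(ℝ, E) M) : coordEndo (tangentJ₁ g) u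
      =ᶠ[𝓝 (extChartAt 𝓘(ℝ, E).tangent u u)] tangentJCoord (coordForm g u.proj) :=
  (eventually_extChartAt_tangent hg u).mono fun _ hz ↦ coordEndo_tangentJ₁ hg u hz.1 hz.2

theorem isAlmostHermitian_sasakiMetric (hg : IsPseudoRiemannianMetric g) :
    IsAlmostHermitian (tangentJ₁ g) (sasakiMetric g) where
  metric :=
    { smooth := fun u ↦ by
        rw [contMDiffAt_bilin_iff, contDiffAt_congr_iff (coordForm_sasakiMetric_eventuallyEq hg u),
          extChartAt_tangent_self]
        exact contDiffAt_sasakiCoord (eventually_coordForm_nondegenerate hg u.proj).self_of_nhds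
          (contDiffAt_coordForm hg u.proj)
      symm := fun u ↦ liftForm_symm (E := E) (hg.symm u.proj) _
      nondegenerate := fun u ↦ liftForm_nondegenerate (E := E) (hg.nondegenerate u.proj) _ }
  almostComplex :=
    { smooth := fun u ↦ by
        rw [contMDiffAt_endo_iff, contDiffAt_congr_iff (coordEndo_tangentJ₁_eventuallyEq hg u),
          extChartAt_tangent_self]
        exact contDiffAt_tangentJCoord (eventually_coordForm_nondegenerate hg u.proj).self_of_nhds
          (contDiffAt_coordForm hg u.proj)
      sq_eq_neg := fun u ↦ liftJ_liftJ (christoffelAt g u.proj u.snd) }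
  isometry := fun u ↦ liftForm_liftJ (E := E) (g u.proj) _

theorem isClosedForm_kaehlerForm_sasakiMetric (hg : IsPseudoRiemannianMetric g) :
    IsClosedForm (kaehlerForm (tangentJ₁ g) (sasakiMetric g)) := by
  intro u ξ η ζ
  have hev : coordForm (kaehlerForm (tangentJ₁ g) (sasakiMetric g)) u
      =ᶠ[𝓝 (extChartAt 𝓘(ℝ, E).tangent u u)] fun z ↦
        (sasakiCoord (coordForm g u.proj) z).comp (tangentJCoord (coordForm g u.proj) z) := by
    filter_upwards [coordForm_sasakiMetric_eventuallyEq hg u,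
      coordEndo_tangentJ₁_eventuallyEq hg u, extChartAt_target_mem_nhds (I := 𝓘(ℝ, E).tangent) u]
      with z h1 h2 h3
    rw [← h1, ← h2]
    refine ContinuousLinearMap.ext fun ξ ↦ ContinuousLinearMap.ext fun η ↦ ?_
    refine bilinField_congr (sasakiMetric g) rfl ?_ rfl
    -- Frame after coframe is the identity and may be inserted between `ĝ` and `J₁`.
    exact (congrArg (fun L : E × E →L[ℝ] E × E ↦ L (tangentJ₁ g _
      (chartFrame (I := 𝓘(ℝ, E).tangent) u z ξ)))
      (chartFrame_comp_chartCoframe (I := 𝓘(ℝ, E).tangent) h3)).symm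
  rw [hev.fderiv_eq, extChartAt_tangent_self]
  exact isClosed_sasakiCoord_tangentJCoord (eventually_coordForm_nondegenerate hg u.proj)
    (contDiffAt_coordForm hg u.proj)
    (Eventually.of_forall fun y ↦ coordForm_symm hg.symm u.proj y) ξ η ζ

theorem nablaEndo_congr {V : Type*} [NormedAddCommGroup V] [NormedSpace ℝ V]
    {H : Type*} [TopologicalSpace H] {I : ModelWithCorners ℝ V H}
    {N : Type*} [TopologicalSpace N] [ChartedSpace H N] {B : BilinField I N} {A : EndoField I N}
    {p : N} {G : V → V →L[ℝ] V →L[ℝ] ℝ} {A' : V → V →L[ℝ] V}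
    (hB : coordForm B p =ᶠ[𝓝 (extChartAt I p p)] G)
    (hA : coordEndo A p =ᶠ[𝓝 (extChartAt I p p)] A') (a b : V) :
    nablaEndo B A p a b = nablaCoord G A' (extChartAt I p p) a b := by
  have h : christoffel B p (extChartAt I p p) = leviCivita G (extChartAt I p p) :=
    leviCivita_congr hB
  rw [nablaEndo, nablaCoord, h, hA.fderiv_eq, hA.self_of_nhds]

theorem nablaEndo_tangentJ₁_eq_zero_iff (hg : IsPseudoRiemannianMetric g)
    (u : TangentBundle 𝓘(ℝ, E) M) :
    (∀ ξ η : E × E, nablaEndo (sasakiMetric g) (tangentJ₁ g) u ξ η = 0) ↔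
      ∀ b c : E, curvature g u.proj b c u.snd = 0 := by
  have h := nablaCoord_sasakiCoord_eq_zero_iff (z := (extChartAt 𝓘(ℝ, E) u.proj u.proj, u.snd))
    (eventually_coordForm_nondegenerate hg u.proj) (contDiffAt_coordForm hg u.proj)
    (Eventually.of_forall fun y ↦ coordForm_symm hg.symm u.proj y)
  refine (forall₂_congr fun ξ η ↦ ?_).trans h
  rw [nablaEndo_congr (coordForm_sasakiMetric_eventuallyEq hg u)
    (coordEndo_tangentJ₁_eventuallyEq hg u), extChartAt_tangent_self]
  exact Iff.rfl

end Main

end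

end SasakiTangent

theorem mainTheorem5 {E : Type*} [NormedAddCommGroup E] [NormedSpace ℝ E] [FiniteDimensional ℝ E]
    {M : Type*} [TopologicalSpace M] [ChartedSpace E M] [IsManifold 𝓘(ℝ, E) ∞ M]
    (J : SasakiTangent.EndoField 𝓘(ℝ, E) M) (g : SasakiTangent.BilinField 𝓘(ℝ, E) M)
    (hM : SasakiTangent.IsAlmostSkewHermitian J g) :
    SasakiTangent.IsAlmostKaehler (SasakiTangent.tangentJ₁ g) (SasakiTangent.sasakiMetric g) ∧
      (SasakiTangent.IsKaehler (SasakiTangent.tangentJ₁ g) (SasakiTangent.sasakiMetric g) ↔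
        SasakiTangent.IsFlat g) := by
  have hH := SasakiTangent.isAlmostHermitian_sasakiMetric hM.metric
  refine ⟨⟨hH, SasakiTangent.isClosedForm_kaehlerForm_sasakiMetric hM.metric⟩, ?_, ?_⟩
  · intro hK p a b c
    -- The vector `c` on which `R(a, b)` acts serves as the point of `TM` over `p`.
    exact (SasakiTangent.nablaEndo_tangentJ₁_eq_zero_iff hM.metric ⟨p, c⟩).1
      (hK.parallel ⟨p, c⟩) a b
  · intro hF
    exact ⟨hH, fun u ↦ (SasakiTangent.nablaEndo_tangentJ₁_eq_zero_iff hM.metric u).2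
      fun b c ↦ hF u.proj b c u.snd⟩
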